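/- Let $\mathbb D$ be the open unit disc, $\mathbb T$ the unit circle, $dA$ the area measure, and for $\alpha>-1$ let $dA_\alpha(z)=\frac{\alpha+1}{\pi}(1-|z|^2)^\alpha\,dA(z)$. The weighted Bergman space $A^2_\alpha$ consists of the holomorphic functions on $\mathbb D$ that are square integrable with respect to $dA_\alpha$, with inner product $\langle f,g\rangle_{A^2_\alpha}=\int_{\mathbb D}f\,\overline g\,dA_\alpha$; write $A^2=A^2_0$. Let $d\lambda(z)=\frac{dA(z)}{\pi(1-|z|^2)^2}$ on $\mathbb D$. For $f(z)=\sum_{n\ge0}a_nz^n$ in $A^2$ put $$V^\alpha f(z)=\sum_{n=0}^\infty\frac{a_n}{\sqrt{n+1}}\sqrt{\frac{\Gamma(n+\alpha+2)}{n!\,\Gamma(\alpha+2)}}\,z^n .$$ For $z\in\mathbb D$ let $\varphi_z(\zeta)=\frac{\zeta-z}{1-\overline z\zeta}$ and $$U^\alpha_z g(\zeta)=g(\varphi_z(\zeta))\left[\frac{1-|z|^2}{(1-\overline z\zeta)^2}\right]^{(2+\alpha)/2}$$ (principal power), and let $g_\theta(\zeta)=g(e^{i\theta}\zeta)$. For a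 window $g\in A^2_\alpha$, the windowed Berezin transform of a function $F$ on $\mathbb T\times\mathbb D$ is $$B^g_\alpha F(e^{i\theta},z)=(\alpha+1)\int_0^{2\pi}\frac{dt}{2\pi}\int_{\mathbb D}F(e^{it},w)\left|\langle U^\alpha_zg_\theta,U^\alpha_wg_t\rangle_{A^2_\alpha}\right|^2d\lambda(w).$$ A function $f$ on $\mathbb D$ is regarded as the function $f(e^{i\theta},z)=f(z)$ on $\mathbb T\times\mathbb D$. **Theorem.** Let $\psi\in A^2$ with $\|\psi\|_{A^2}=1$, let $\psi^\alpha=V^\alpha\psi$, let $1\le p<\infty$, and let $f\in L^p(\mathbb D,d\lambda)$. Then for every $\alpha>-1$ the integral that defines $B^{\psi^\alpha}_\alpha f(e^{i\theta},z)$ converges absolutely for every $(e^{i\theta},z)\in\mathbb T\times\mathbb D$, the function $B^{\psi^\alpha}_\alpha f$ belongs to $L^p\left(\mathbb T\times\mathbb D,\frac{d\theta}{2\pi}d\lambda\right)$, and $$\lim_{\alpha\to\infty}\left\|B^{\psi^\alpha}_\alpha f-f\right\|_{L^p\left(\mathbb T\times\mathbb D,\,\frac{d\theta}{2\pi}d\lambda\right)}=0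 .$$ -/

import Mathlib

open MeasureTheory Filter Topology
open scoped ENNReal ComplexConjugate

noncomputable section

namespace BergmanWindow

/-- The unit circle carries its Borel sigma-algebra. -/
instance : MeasurableSpace Circle := borel Circle

instance : BorelSpace Circle := ⟨rfl⟩

/-- The open unit disc of the complex plane. -/
def disc : Set ℂ := Metric.ball 0 1

/-- The normalized arc length measure `dθ / 2π` on the unit circle: the image of `dθ / 2π` on
`(0, 2π]` under `θ ↦ e^{iθ}`. -/
def circleMeasure : Measure Circle :=
  Measure.map Circle.exp
    (ENNReal.ofReal (1 / (2 * Real.pi)) • volume.restrict (Set.Ioc 0 (2 * Real.pi)))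

/-- The Möbius invariant area measure `dλ(z) = dA(z) / (π (1 - |z|²)²)` on the disc, as a measure
on `ℂ` that is concentrated on the disc. -/
def moebiusMeasure : Measure ℂ :=
  (volume.restrict disc).withDensity
    (fun z => ENNReal.ofReal (1 / (Real.pi * (1 - ‖z‖ ^ 2) ^ 2)))

/-- The product measure `(dθ / 2π) dλ` on the product of the circle and the disc. -/
def haarMeasureTD : Measure (Circle × ℂ) := circleMeasure.prod moebiusMeasure

/-- The weighted area measure `dA_α(z) = ((α + 1) / π) (1 - |z|²)^α dA(z)` on the disc. -/
def bergmanMeasure (α : ℝ) : Measure ℂ :=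
  (volume.restrict disc).withDensity
    (fun z => ENNReal.ofReal ((α + 1) / Real.pi * (1 - ‖z‖ ^ 2) ^ α))

/-- Membership in the weighted Bergman space `A²_α`: holomorphic on the disc and
square integrable with respect to `dA_α`. Values outside the disc play no role. -/
structure MemBergman (α : ℝ) (f : ℂ → ℂ) : Prop where
  holomorphic : DifferentiableOn ℂ f disc
  memLp : MemLp f 2 (bergmanMeasure α)

/-- The inner product of `A²_α`, linear in the first variable. -/
def bergmanInner (α : ℝ) (f g : ℂ → ℂ) : ℂ :=
  ∫ ζ, f ζ * conj (g ζ) ∂(bergmanMeasure α)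

/-- The norm of `A²_α`. -/
def bergmanNorm (α : ℝ) (f : ℂ → ℂ) : ℝ :=
  Real.sqrt (∫ ζ, ‖f ζ‖ ^ 2 ∂(bergmanMeasure α))

/-- The `n`-th Taylor coefficient of `f` at the origin. -/
def taylorCoeff (f : ℂ → ℂ) (n : ℕ) : ℂ :=
  iteratedDeriv n f 0 / (n.factorial : ℂ)

/-- The operator `V^α`, which sends `∑ a_n z^n` to
`∑ a_n / √(n + 1) * √(Γ(n + α + 2) / (n! Γ(α + 2))) z^n`. -/
def fracDiff (α : ℝ) (f : ℂ → ℂ) (z : ℂ) : ℂ :=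
  ∑' n : ℕ,
    taylorCoeff f n / (Real.sqrt ((n : ℝ) + 1) : ℂ) *
      (Real.sqrt (Real.Gamma ((n : ℝ) + α + 2) /
        ((n.factorial : ℝ) * Real.Gamma (α + 2))) : ℂ) * z ^ n

/-- The Möbius map `φ_z(ζ) = (ζ - z) / (1 - conj z * ζ)`. -/
def moebius (z ζ : ℂ) : ℂ := (ζ - z) / (1 - conj z * ζ)

/-- The operator `U^α_z`. For `z` and `ζ` in the disc `1 - conj z * ζ` has positive real part, so
the base of the power avoids the closed negative axis and the principal power is holomorphic
in `ζ`. -/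
def moebiusShift (α : ℝ) (z : ℂ) (f : ℂ → ℂ) (ζ : ℂ) : ℂ :=
  f (moebius z ζ) *
    ((1 - (‖z‖ : ℂ) ^ 2) / (1 - conj z * ζ) ^ 2) ^ (((2 + α) / 2 : ℝ) : ℂ)

/-- The rotated function `f_θ(ζ) = f(e^{iθ} ζ)`, with `u = e^{iθ}`. -/
def rotate (u : Circle) (f : ℂ → ℂ) (ζ : ℂ) : ℂ := f ((u : ℂ) * ζ)

/-- The kernel `|⟨U^α_z ψ_θ, U^α_w ψ_t⟩|²` at the points `(e^{iθ}, z)` and `(e^{it}, w)`. -/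
def berezinKernel (α : ℝ) (ψ : ℂ → ℂ) (a b : Circle × ℂ) : ℝ :=
  ‖bergmanInner α (moebiusShift α a.2 (rotate a.1 ψ)) (moebiusShift α b.2 (rotate b.1 ψ))‖ ^ 2

/-- The windowed Berezin transform with window `ψ` of a function `F` on the product of the circle
and the disc. -/
def windowedBerezin (α : ℝ) (ψ : ℂ → ℂ) (F : Circle × ℂ → ℂ) (a : Circle × ℂ) : ℂ :=
  ((α + 1 : ℝ) : ℂ) *
    ∫ u, (∫ w, F (u, w) * (berezinKernel α ψ a (u, w) : ℂ) ∂moebiusMeasure) ∂circleMeasure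

/-- A function on the disc, regarded as a function on the product of the circle and the disc that
does not depend on the first variable. -/
def liftTD (f : ℂ → ℂ) (a : Circle × ℂ) : ℂ := f a.2

end BergmanWindow

end

/-!
The proof treats `(α + 1) |⟨U_z ψ_θ, U_w ψ_t⟩|²` as the density of a symmetric Markov kernel on the
product of the circle and the disc, and shows that this kernel concentrates on `{w = z}` as `α → ∞`.

*Windows.* With `γ_n = Γ(n + α + 2) / (n! Γ(α + 2))` (`coeffWeight`), the monomials `e_n = √γ_n ζ^n`
form an orthonormal system of `A²_α`, and `V^α` moves the normalized coefficients `β_n` of `ψ` from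
the basis of `A²` to that of `A²_α`. Hence `‖V^α ψ‖ = 1`. By Chebyshev's inequality and dominated
convergence the windows concentrate at the origin (`tendsto_window_tail`).

*Matrix coefficients.* The adjoint of `U_w` is `U_{-w}` (`bergmanInner_moebiusShift_right`), so `⟨h,
U_w e_n⟩` is, up to normalization, a Taylor coefficient of `U_{-w} h`. Parseval's identity on the
circle then gives two formulas: the average of `|⟨h, U_w ψ_t⟩|²` over `t` is `∑ |β_n|² m_n(w)` with
`m_n(w) = |⟨h, U_w e_n⟩|²` (`lintegral_circle_bergmanInner_moebiusShift`), and `(1 - r²)^(α + 2) ∑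
γ_n r^(2n) m_n(w)` is the average over `u` of the function `(1 - |ζ|²)^(α + 2) |h(ζ)|²` at `ζ =
φ_{-w}(r u)` (`lintegral_circle_invariantDensity`). Averaged over `u`, the map `w ↦ φ_{-w}(r u)`
preserves `λ` (`lintegral_moebius_neg_average`). Integrating the second formula over the disc
therefore shows that `∑ γ_n M_n x^n = (1 - x)^(-(α + 2)) ‖h‖²`, where `x = r²` and `M_n` is `α + 1`
times the total mass of `m_n`. The right side is the binomial series `‖h‖² ∑ γ_n x^n`, so
`M_n = ‖h‖²` for every `n` (`lintegral_coeffMass`). This is Schur orthogonality obtained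
without group theory, and it makes the kernel Markov
(`isSymmMarkovDensity_berezinDensity`).

*Concentration.* Integrated only over the `w` that are far from `z`, the same formula with `r² = 1 /
(α + 2)` bounds the far mass of `m_n` by `4 n!` times the tail of the window, because `φ_{-w}(r u)`
is within `2 r` of `w` (`setLIntegral_berezinDensity_far_le`). Summing against `|β_n|²` by dominated
convergence shows that the far mass of the kernel tends to zero.

*Convergence.* Jensen's inequality bounds `‖B f - f‖_p` by the `L^p` norm of `f(y) - f(x)` with
respect to the joint measure `k(x, y) dx dy`, both of whose marginals are the original measure. By
symmetry and concentration this tends to zero when `f` is bounded, vanishes off a smaller disc and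
is continuous almost everywhere (`tendsto_eLpNorm_diff_of_bounded`), and such functions are dense.
-/

noncomputable section

namespace BergmanWindow

/-! ### The circle -/

instance fact_two_pi_pos : Fact (0 < 2 * Real.pi) := ⟨by positivity⟩

theorem circleMeasure_eq_map_toCircle :
    circleMeasure = (ENNReal.ofReal (1 / (2 * Real.pi))) •
      Measure.map (AddCircle.toCircle (T := 2 * Real.pi))
        (volume : Measure (AddCircle (2 * Real.pi))) := by
  have h := (AddCircle.measurePreserving_mk (2 * Real.pi) 0).map_eq
  rw [← h, Measure.map_map (AddCircle.continuous_toCircle.measurable)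
    (AddCircle.measurePreserving_mk (2 * Real.pi) 0).measurable, circleMeasure,
    Measure.map_smul, zero_add]
  congr 2
  ext1 t
  simp [AddCircle.toCircle_apply_mk, Real.pi_ne_zero]

instance : IsProbabilityMeasure circleMeasure := by
  constructor
  rw [circleMeasure, Measure.map_apply Circle.exp.continuous.measurable MeasurableSet.univ]
  simp only [Set.preimage_univ, Measure.smul_apply, Measure.restrict_apply_univ, Real.volume_Ioc,
    smul_eq_mul, sub_zero]
  rw [← ENNReal.ofReal_mul (by positivity), one_div, inv_mul_cancel₀ (by positivity),
    ENNReal.ofReal_one]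

instance : Measure.IsMulLeftInvariant circleMeasure := by
  constructor
  intro v
  obtain ⟨s, rfl⟩ : ∃ s, AddCircle.toCircle (T := 2 * Real.pi) s = v := by
    obtain ⟨t, rfl⟩ := Circle.exp_surjective v
    refine ⟨(t : AddCircle (2 * Real.pi)), ?_⟩
    simp [AddCircle.toCircle_apply_mk, Real.pi_ne_zero]
  have hm := (AddCircle.continuous_toCircle (T := 2 * Real.pi)).measurable
  rw [circleMeasure_eq_map_toCircle, Measure.map_smul, Measure.map_map (by fun_prop) hm]
  congr 1
  conv_rhs => rw [← map_add_left_eq_self (volume : Measure (AddCircle (2 * Real.pi))) s]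
  rw [Measure.map_map hm (by fun_prop)]
  congr 1
  ext1 t
  simp [AddCircle.toCircle_add]

theorem lintegral_circle_mul_left (v : Circle) (F : Circle → ℝ≥0∞) :
    ∫⁻ u, F (v * u) ∂circleMeasure = ∫⁻ u, F u ∂circleMeasure :=
  lintegral_mul_left_eq_self F v

/-- By invariance under a rotation `v` with `v ^ k = -1`, the integral equals its own negative. -/
theorem integral_circle_zpow {k : ℤ} (hk : k ≠ 0) :
    ∫ u : Circle, ((u ^ k : Circle) : ℂ) ∂circleMeasure = 0 := by
  have h (v : Circle) : ((v ^ k : Circle) : ℂ) * ∫ u : Circle, ((u ^ k : Circle) : ℂ) ∂circleMeasure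
      = ∫ u : Circle, ((u ^ k : Circle) : ℂ) ∂circleMeasure := by
    rw [← integral_const_mul]
    conv_rhs => rw [← integral_mul_left_eq_self _ v]
    simp [mul_zpow]
  have hv : ((Circle.exp (Real.pi / k)) ^ k : Circle) = Circle.exp Real.pi := by
    rw [← Circle.exp_zsmul]
    congr 1
    rw [zsmul_eq_mul]
    have : (k : ℝ) ≠ 0 := by exact_mod_cast hk
    field_simp
  have h1 := h (Circle.exp (Real.pi / k))
  rw [hv] at h1
  simp only [Circle.coe_exp, Complex.exp_pi_mul_I] at h1
  linear_combination (-1 / 2 : ℂ) * h1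

theorem integral_circle_pow_mul_conj_pow (m n : ℕ) :
    ∫ u : Circle, (u : ℂ) ^ m * conj ((u : ℂ) ^ n) ∂circleMeasure = if m = n then 1 else 0 := by
  have h (u : Circle) : (u : ℂ) ^ m * conj ((u : ℂ) ^ n) = ((u ^ ((m : ℤ) - n) : Circle) : ℂ) := by
    rw [map_pow, ← Circle.coe_inv_eq_conj, ← Circle.coe_pow, ← Circle.coe_pow, ← Circle.coe_mul,
      zpow_sub]
    simp
  simp_rw [h]
  split_ifs with hmn
  · simp [hmn]
  · exact integral_circle_zpow (by omega)

theorem integrable_circle_of_continuous {F : Circle → ℂ} (hF : Continuous F) :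
    Integrable F circleMeasure :=
  hF.integrable_of_hasCompactSupport (HasCompactSupport.of_compactSpace F)

/-- Parseval's identity on the circle, for absolutely summable coefficients. -/
theorem integral_circle_series {a b : ℕ → ℂ} (ha : Summable fun n => ‖a n‖)
    (hb : Summable fun n => ‖b n‖) :
    ∫ u : Circle, (∑' n, a n * (u : ℂ) ^ n) * conj (∑' n, b n * (u : ℂ) ^ n) ∂circleMeasure
      = ∑' n, a n * conj (b n) := by
  have hpow (u : Circle) (c : ℂ) (n : ℕ) : ‖c * (u : ℂ) ^ n‖ = ‖c‖ := by
    rw [norm_mul, norm_pow, Circle.norm_coe, one_pow, mul_one]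
  have hprod (u : Circle) : (∑' n, a n * (u : ℂ) ^ n) * conj (∑' n, b n * (u : ℂ) ^ n)
      = ∑' q : ℕ × ℕ, (a q.1 * (u : ℂ) ^ q.1) * conj (b q.2 * (u : ℂ) ^ q.2) := by
    rw [Complex.conj_tsum]
    exact tsum_mul_tsum_of_summable_norm (by simpa only [hpow] using ha)
      (by simpa only [RCLike.norm_conj, hpow] using hb)
  simp_rw [hprod]
  have hab : Summable fun q : ℕ × ℕ => ‖a q.1‖ * ‖b q.2‖ := ha.mul_of_nonneg hb
    (fun _ => norm_nonneg _) (fun _ => norm_nonneg _)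
  rw [← integral_tsum_of_summable_integral_norm]
  · have (q : ℕ × ℕ) : ∫ u : Circle, (a q.1 * (u : ℂ) ^ q.1) * conj (b q.2 * (u : ℂ) ^ q.2)
        ∂circleMeasure = if q.1 = q.2 then a q.1 * conj (b q.1) else 0 := by
      have h2 (u : Circle) : (a q.1 * (u : ℂ) ^ q.1) * conj (b q.2 * (u : ℂ) ^ q.2)
        = a q.1 * conj (b q.2) * ((u : ℂ) ^ q.1 * conj ((u : ℂ) ^ q.2)) := by
        rw [map_mul]; ring
      simp_rw [h2, integral_const_mul, integral_circle_pow_mul_conj_pow]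
      split_ifs with h <;> simp [h]
    simp_rw [this]
    rw [Summable.tsum_prod']
    · congr 1
      ext1 n
      rw [tsum_eq_single n]
      · simp
      · intro m hm; simp [hm.symm]
    · refine Summable.of_norm_bounded hab ?_
      rintro ⟨m, n⟩
      dsimp only
      split_ifs with h
      · subst h; simp
      · simp; positivity
    · intro m
      refine summable_of_ne_finset_zero (s := {m}) ?_
      intro n hn
      have : m ≠ n := by simpa [eq_comm] using hn
      simp [this]
  · intro q
    exact integrable_circle_of_continuous (by fun_prop)
  · simpa only [norm_mul, RCLike.norm_conj, norm_pow, Circle.norm_coe, one_pow, mul_one,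
      integral_const, probReal_univ, one_smul] using hab

theorem continuous_circle_series {a : ℕ → ℂ} (ha : Summable fun n => ‖a n‖) :
    Continuous fun u : Circle => ∑' n, a n * (u : ℂ) ^ n :=
  continuous_tsum (fun n => by fun_prop) ha
    (fun n u => by rw [norm_mul, norm_pow, Circle.norm_coe, one_pow, mul_one])

theorem lintegral_circle_series {a : ℕ → ℂ} (ha : Summable fun n => ‖a n‖) :
    ∫⁻ u : Circle, ‖∑' n, a n * (u : ℂ) ^ n‖ₑ ^ 2 ∂circleMeasure = ∑' n, ‖a n‖ₑ ^ 2 := by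
  have h := integral_circle_series ha ha
  have hc := continuous_circle_series ha
  have hs : Summable fun n => ‖a n‖ ^ 2 := by
    simpa using ha.of_norm_bounded_eventually_nat (g := fun n => ‖a n‖) (f := fun n => ‖a n‖ ^ 2)
      (by
        filter_upwards [ha.tendsto_atTop_zero.eventually_le_const zero_lt_one] with n hn
        rw [Real.norm_of_nonneg (by positivity), sq]
        exact mul_le_of_le_one_left (norm_nonneg _) hn)
  have h3 : ∫ u : Circle, ‖∑' n, a n * (u : ℂ) ^ n‖ ^ 2 ∂circleMeasure = ∑' n, ‖a n‖ ^ 2 := by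
    have : ((∫ u : Circle, ‖∑' n, a n * (u : ℂ) ^ n‖ ^ 2 ∂circleMeasure : ℝ) : ℂ)
        = ((∑' n, ‖a n‖ ^ 2 : ℝ) : ℂ) := by
      rw [← integral_complex_ofReal, Complex.ofReal_tsum]
      simpa [Complex.mul_conj'] using h
    exact_mod_cast this
  have e (x : ℂ) : ‖x‖ₑ ^ 2 = ENNReal.ofReal (‖x‖ ^ 2) := by
    rw [ENNReal.ofReal_pow (norm_nonneg _), ofReal_norm]
  simp_rw [e]
  rw [← ENNReal.ofReal_tsum_of_nonneg (fun n => by positivity) hs, ← h3,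
    ofReal_integral_eq_lintegral_ofReal]
  · exact (hc.norm.pow 2).integrable_of_hasCompactSupport (HasCompactSupport.of_compactSpace _)
  · exact ae_of_all _ (fun u => by positivity)

/-! ### Möbius maps of the disc -/

theorem mem_disc {z : ℂ} : z ∈ disc ↔ ‖z‖ < 1 := by simp [disc]

theorem measurableSet_disc : MeasurableSet disc := Metric.isOpen_ball.measurableSet

theorem neg_mem_disc {z : ℂ} (hz : z ∈ disc) : -z ∈ disc := by
  rw [mem_disc] at *; simpa using hz

theorem circle_mul_mem_disc {z : ℂ} (u : Circle) : (u : ℂ) * z ∈ disc ↔ z ∈ disc := by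
  rw [mem_disc, mem_disc, norm_mul, Circle.norm_coe, one_mul]

theorem one_sub_sq_pos {z : ℂ} (hz : z ∈ disc) : 0 < 1 - ‖z‖ ^ 2 := by
  rw [mem_disc] at hz
  nlinarith [norm_nonneg z]

theorem re_one_sub_conj_mul_pos {z ζ : ℂ} (hz : z ∈ disc) (hζ : ζ ∈ disc) :
    0 < (1 - conj z * ζ).re := by
  rw [mem_disc] at *
  have h : (conj z * ζ).re ≤ ‖z‖ * ‖ζ‖ := by
    simpa using Complex.re_le_norm (conj z * ζ)
  have : ‖z‖ * ‖ζ‖ < 1 := by nlinarith [norm_nonneg z, norm_nonneg ζ]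
  simp only [Complex.sub_re, Complex.one_re]
  linarith

theorem one_sub_conj_mul_ne_zero {z ζ : ℂ} (hz : z ∈ disc) (hζ : ζ ∈ disc) :
    1 - conj z * ζ ≠ 0 := fun h => by
  have := re_one_sub_conj_mul_pos hz hζ
  simp [h] at this

/-- The derivative `(1 - |z|²) / (1 - conj z * ζ)²` of the Möbius map `φ_z` at `ζ`. -/
def moebiusDeriv (z ζ : ℂ) : ℂ := (1 - (‖z‖ : ℂ) ^ 2) / (1 - conj z * ζ) ^ 2

theorem moebiusDeriv_ne_zero {z ζ : ℂ} (hz : z ∈ disc) (hζ : ζ ∈ disc) :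
    moebiusDeriv z ζ ≠ 0 := by
  refine div_ne_zero ?_ (pow_ne_zero _ (one_sub_conj_mul_ne_zero hz hζ))
  exact_mod_cast (one_sub_sq_pos hz).ne'

theorem hasDerivAt_moebius {z ζ : ℂ} (hz : z ∈ disc) (hζ : ζ ∈ disc) :
    HasDerivAt (moebius z) (moebiusDeriv z ζ) ζ := by
  have h0 := one_sub_conj_mul_ne_zero hz hζ
  have h1 : HasDerivAt (fun ζ : ℂ => ζ - z) 1 ζ := (hasDerivAt_id ζ).sub_const z
  have h2 : HasDerivAt (fun ζ : ℂ => 1 - conj z * ζ) (-conj z) ζ := by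
    simpa using ((hasDerivAt_id ζ).const_mul (conj z)).const_sub 1
  convert! h1.div h2 h0 using 1
  rw [moebiusDeriv, ← Complex.mul_conj']
  congr 1
  ring

/-- The identity behind the transformation rule of `1 - |ζ|²` under Möbius maps. -/
theorem norm_one_sub_conj_mul_sq (z ζ : ℂ) :
    ‖1 - conj z * ζ‖ ^ 2 - ‖ζ - z‖ ^ 2 = (1 - ‖z‖ ^ 2) * (1 - ‖ζ‖ ^ 2) := by
  simp only [← Complex.normSq_eq_norm_sq, Complex.normSq_apply, Complex.sub_re, Complex.sub_im,
    Complex.mul_re, Complex.mul_im, Complex.one_re, Complex.one_im, Complex.conj_re,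
    Complex.conj_im]
  ring

theorem one_sub_norm_moebius_sq {z ζ : ℂ} (hz : z ∈ disc) (hζ : ζ ∈ disc) :
    1 - ‖moebius z ζ‖ ^ 2 = (1 - ‖ζ‖ ^ 2) * ‖moebiusDeriv z ζ‖ := by
  have h0 := one_sub_conj_mul_ne_zero hz hζ
  have h1 : ‖(1 : ℂ) - (‖z‖ : ℂ) ^ 2‖ = 1 - ‖z‖ ^ 2 := by
    have : (1 : ℂ) - (‖z‖ : ℂ) ^ 2 = ((1 - ‖z‖ ^ 2 : ℝ) : ℂ) := by push_cast; rfl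
    rw [this, Complex.norm_real, Real.norm_of_nonneg (one_sub_sq_pos hz).le]
  have h2 : ‖1 - conj z * ζ‖ ≠ 0 := norm_ne_zero_iff.2 h0
  rw [moebius, moebiusDeriv, norm_div, norm_div, norm_pow, h1, div_pow,
    one_sub_div (pow_ne_zero 2 h2), norm_one_sub_conj_mul_sq]
  ring

theorem moebius_mem_disc {z ζ : ℂ} (hz : z ∈ disc) (hζ : ζ ∈ disc) : moebius z ζ ∈ disc := by
  have h := one_sub_norm_moebius_sq hz hζ
  have h1 := one_sub_sq_pos hζ
  have h2 := norm_pos_iff.2 (moebiusDeriv_ne_zero hz hζ)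
  rw [mem_disc]
  have : 0 < 1 - ‖moebius z ζ‖ ^ 2 := by rw [h]; positivity
  nlinarith [norm_nonneg (moebius z ζ)]

theorem one_sub_conj_mul_moebius {z ζ : ℂ} (hz : z ∈ disc) (hζ : ζ ∈ disc) :
    1 + conj z * moebius z ζ = (1 - (‖z‖ : ℂ) ^ 2) / (1 - conj z * ζ) := by
  have h0 := one_sub_conj_mul_ne_zero hz hζ
  rw [moebius, ← Complex.mul_conj', eq_div_iff h0, add_mul, mul_assoc, div_mul_cancel₀ _ h0]
  ring

theorem moebius_neg_moebius {z ζ : ℂ} (hz : z ∈ disc) (hζ : ζ ∈ disc) :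
    moebius (-z) (moebius z ζ) = ζ := by
  have h0 := one_sub_conj_mul_ne_zero hz hζ
  have h1 : (1 : ℂ) - (‖z‖ : ℂ) ^ 2 ≠ 0 := by exact_mod_cast (one_sub_sq_pos hz).ne'
  have h2 := one_sub_conj_mul_moebius hz hζ
  have h3 : moebius z ζ + z = ζ * ((1 - (‖z‖ : ℂ) ^ 2) / (1 - conj z * ζ)) := by
    rw [moebius, ← Complex.mul_conj', mul_div_assoc', eq_div_iff h0, add_mul, div_mul_cancel₀ _ h0]
    ring
  conv_lhs => rw [moebius]
  rw [map_neg, neg_mul, sub_neg_eq_add, sub_neg_eq_add, h2, h3,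
    mul_div_cancel_right₀ _ (div_ne_zero h1 h0)]

theorem moebius_moebius_neg {z ζ : ℂ} (hz : z ∈ disc) (hζ : ζ ∈ disc) :
    moebius z (moebius (-z) ζ) = ζ := by
  simpa using moebius_neg_moebius (neg_mem_disc hz) hζ

theorem moebiusDeriv_moebius_neg {z ζ : ℂ} (hz : z ∈ disc) (hζ : ζ ∈ disc) :
    moebiusDeriv z (moebius (-z) ζ) = (moebiusDeriv (-z) ζ)⁻¹ := by
  have h0 := one_sub_conj_mul_ne_zero (neg_mem_disc hz) hζ
  have h1 : (1 : ℂ) - (‖z‖ : ℂ) ^ 2 ≠ 0 := by exact_mod_cast (one_sub_sq_pos hz).ne'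
  have h2 := one_sub_conj_mul_moebius (neg_mem_disc hz) hζ
  simp only [map_neg, neg_mul, norm_neg, ← sub_eq_add_neg] at h2 h0
  rw [moebiusDeriv, moebiusDeriv, h2, map_neg, neg_mul, norm_neg]
  field_simp

theorem injOn_moebius {z : ℂ} (hz : z ∈ disc) : Set.InjOn (moebius z) disc :=
  fun x hx y hy h => by rw [← moebius_neg_moebius hz hx, h, moebius_neg_moebius hz hy]

theorem image_moebius {z : ℂ} (hz : z ∈ disc) : moebius z '' disc = disc := by
  ext y
  constructor
  · rintro ⟨x, hx, rfl⟩; exact moebius_mem_disc hz hx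
  · intro hy
    exact ⟨moebius (-z) y, moebius_mem_disc (neg_mem_disc hz) hy, moebius_moebius_neg hz hy⟩

theorem measurable_moebius_uncurry : Measurable fun q : ℂ × ℂ => moebius q.1 q.2 := by
  unfold moebius
  have : Measurable (fun z : ℂ => conj z) := Complex.continuous_conj.measurable
  fun_prop

theorem measurable_moebius (z : ℂ) : Measurable (moebius z) := by
  unfold moebius; fun_prop

theorem measurable_moebiusDeriv_uncurry : Measurable fun q : ℂ × ℂ => moebiusDeriv q.1 q.2 := by
  unfold moebiusDeriv
  have : Measurable (fun z : ℂ => conj z) := Complex.continuous_conj.measurable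
  fun_prop

/-! ### Invariance of the Möbius measure -/

theorem measurable_moebiusDensity :
    Measurable fun z : ℂ => ENNReal.ofReal (1 / (Real.pi * (1 - ‖z‖ ^ 2) ^ 2)) := by
  fun_prop

theorem ae_mem_disc : ∀ᵐ z ∂moebiusMeasure, z ∈ disc :=
  (withDensity_absolutelyContinuous _ _).ae_le (ae_restrict_mem measurableSet_disc)

theorem lintegral_moebiusMeasure {g : ℂ → ℝ≥0∞} (hg : Measurable g) :
    ∫⁻ z, g z ∂moebiusMeasure
      = ∫⁻ z in disc, ENNReal.ofReal (1 / (Real.pi * (1 - ‖z‖ ^ 2) ^ 2)) * g z := by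
  rw [moebiusMeasure, lintegral_withDensity_eq_lintegral_mul _ measurable_moebiusDensity hg]
  rfl

instance : SigmaFinite moebiusMeasure := by
  unfold moebiusMeasure
  exact SigmaFinite.withDensity_of_ne_top (ae_of_all _ fun z => ENNReal.ofReal_ne_top)

theorem measurePreserving_moebius {z : ℂ} (hz : z ∈ disc) :
    MeasurePreserving (moebius z) moebiusMeasure moebiusMeasure := by
  refine ⟨measurable_moebius z, ?_⟩
  refine Measure.ext_of_lintegral _ fun g hg => ?_
  rw [lintegral_map hg (measurable_moebius z),
    lintegral_moebiusMeasure (g := fun x => g (moebius z x)) (hg.comp (measurable_moebius z)),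
    lintegral_moebiusMeasure hg]
  have hf' : ∀ x ∈ disc, HasFDerivWithinAt (moebius z)
      ((ContinuousLinearMap.toSpanSingleton ℂ (moebiusDeriv z x)).restrictScalars ℝ) disc x :=
    fun x hx => ((hasDerivAt_moebius hz hx).hasFDerivAt.restrictScalars ℝ).hasFDerivWithinAt
  have key := lintegral_image_eq_lintegral_abs_det_fderiv_mul volume measurableSet_disc hf'
    (injOn_moebius hz)
    (fun z => ENNReal.ofReal (1 / (Real.pi * (1 - ‖z‖ ^ 2) ^ 2)) * g z)
  rw [image_moebius hz] at key
  rw [key]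
  refine setLIntegral_congr_fun measurableSet_disc fun x hx => ?_
  have hdet : |((ContinuousLinearMap.toSpanSingleton ℂ (moebiusDeriv z x)).restrictScalars ℝ).det|
      = ‖moebiusDeriv z x‖ ^ 2 := by
    simp [ContinuousLinearMap.det, LinearMap.det_restrictScalars,
      Algebra.norm_complex_eq, Complex.normSq_eq_norm_sq]
  rw [hdet, ← mul_assoc, ← ENNReal.ofReal_mul (by positivity), one_sub_norm_moebius_sq hz hx]
  congr 2
  have h1 := (one_sub_sq_pos hx).ne'
  have h2 := (norm_pos_iff.2 (moebiusDeriv_ne_zero hz hx)).ne'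
  field_simp

theorem measurePreserving_circle_mul (u : Circle) :
    MeasurePreserving (fun z : ℂ => (u : ℂ) * z) moebiusMeasure moebiusMeasure := by
  have hm : Measurable fun z : ℂ => (u : ℂ) * z := by fun_prop
  refine ⟨hm, ?_⟩
  refine Measure.ext_of_lintegral _ fun g hg => ?_
  rw [lintegral_map hg hm,
    lintegral_moebiusMeasure (g := fun x => g ((u : ℂ) * x)) (hg.comp hm),
    lintegral_moebiusMeasure hg,
    ← lintegral_indicator measurableSet_disc, ← lintegral_indicator measurableSet_disc]
  rw [← ((rotation u).measurePreserving).lintegral_comp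
    (f := disc.indicator fun z => ENNReal.ofReal (1 / (Real.pi * (1 - ‖z‖ ^ 2) ^ 2)) * g z)
    ((measurable_moebiusDensity.mul hg).indicator measurableSet_disc)]
  refine lintegral_congr fun z => ?_
  by_cases hz : z ∈ disc
  · have : (rotation u) z ∈ disc := by simpa [rotation_apply, circle_mul_mem_disc] using hz
    rw [Set.indicator_of_mem hz, Set.indicator_of_mem this]
    rw [rotation_apply, norm_mul, Circle.norm_coe, one_mul]
  · have : (rotation u) z ∉ disc := by simpa [rotation_apply, circle_mul_mem_disc] using hz
    rw [Set.indicator_of_notMem hz, Set.indicator_of_notMem this]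

theorem moebius_circle_mul (u : Circle) (w ζ : ℂ) :
    moebius ((u : ℂ) * w) ((u : ℂ) * ζ) = (u : ℂ) * moebius w ζ := by
  have hu : conj (u : ℂ) * (u : ℂ) = 1 := by
    rw [← Circle.coe_inv_eq_conj, ← Circle.coe_mul]; simp
  have : conj ((u : ℂ) * w) * ((u : ℂ) * ζ) = conj w * ζ := by
    rw [map_mul]; linear_combination (conj w * ζ) * hu
  rw [moebius, moebius, this]
  ring

/-- `φ_{-w}(x)` and `φ_{-x}(w)` differ by a rotation. -/
theorem exists_moebius_neg_swap {x w : ℂ} (hx : x ∈ disc) (hw : w ∈ disc) :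
    ∃ v : Circle, moebius (-w) x = (v : ℂ) * moebius (-x) w := by
  have h1 := one_sub_conj_mul_ne_zero (neg_mem_disc hw) hx
  have h2 := one_sub_conj_mul_ne_zero (neg_mem_disc hx) hw
  have h3 : conj (1 - conj (-w) * x) = 1 - conj (-x) * w := by simp [mul_comm]
  have hcoe : (Circle.ofConjDivSelf (1 - conj (-w) * x) h1 : ℂ)
      = conj (1 - conj (-w) * x) / (1 - conj (-w) * x) := rfl
  refine ⟨Circle.ofConjDivSelf (1 - conj (-w) * x) h1, ?_⟩
  rw [hcoe, h3, moebius, moebius, div_mul_div_comm, mul_comm (1 - conj (-x) * w),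
    mul_div_mul_right _ _ h2]
  ring

theorem measurable_circle_coe : Measurable fun u : Circle => (u : ℂ) :=
  (by fun_prop : Continuous fun u : Circle => (u : ℂ)).measurable

/-- Averaging over the rotations makes `w ↦ φ_{-w}(x)` preserve the Möbius measure. -/
theorem lintegral_moebius_neg_average {x : ℂ} (hx : x ∈ disc) {H : ℂ → ℝ≥0∞} (hH : Measurable H) :
    ∫⁻ w, (∫⁻ u : Circle, H (moebius (-w) ((u : ℂ) * x)) ∂circleMeasure) ∂moebiusMeasure
      = ∫⁻ w, H w ∂moebiusMeasure := by
  have hcm := measurable_circle_coe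
  have hm1 : Measurable fun q : ℂ × Circle => H (moebius (-q.1) ((q.2 : ℂ) * x)) := by
    refine hH.comp (measurable_moebius_uncurry.comp (Measurable.prodMk (by fun_prop) ?_))
    exact (hcm.comp measurable_snd).mul_const x
  have hm2 : Measurable fun q : Circle × ℂ => H ((q.1 : ℂ) * moebius (-q.2) x) := by
    refine hH.comp ((hcm.comp measurable_fst).mul ?_)
    exact measurable_moebius_uncurry.comp (Measurable.prodMk (by fun_prop) (by fun_prop))
  have hm3 : Measurable fun q : ℂ × Circle => H ((q.2 : ℂ) * moebius (-x) q.1) :=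
    hH.comp ((hcm.comp measurable_snd).mul ((measurable_moebius _).comp measurable_fst))
  calc ∫⁻ w, (∫⁻ u : Circle, H (moebius (-w) ((u : ℂ) * x)) ∂circleMeasure) ∂moebiusMeasure
      = ∫⁻ u : Circle, ∫⁻ w, H (moebius (-w) ((u : ℂ) * x)) ∂moebiusMeasure ∂circleMeasure :=
        lintegral_lintegral_swap hm1.aemeasurable
    _ = ∫⁻ u : Circle, ∫⁻ w, H ((u : ℂ) * moebius (-w) x) ∂moebiusMeasure ∂circleMeasure := by
        refine lintegral_congr fun u => ?_
        have hm : Measurable fun w : ℂ => H (moebius (-w) ((u : ℂ) * x)) :=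
          hH.comp (measurable_moebius_uncurry.comp (measurable_neg.prodMk measurable_const))
        rw [← (measurePreserving_circle_mul u).lintegral_comp hm]
        simp_rw [← mul_neg, moebius_circle_mul]
    _ = ∫⁻ w, ∫⁻ u : Circle, H ((u : ℂ) * moebius (-w) x) ∂circleMeasure ∂moebiusMeasure :=
        lintegral_lintegral_swap hm2.aemeasurable
    _ = ∫⁻ w, ∫⁻ u : Circle, H ((u : ℂ) * moebius (-x) w) ∂circleMeasure ∂moebiusMeasure := by
        refine lintegral_congr_ae ?_
        filter_upwards [ae_mem_disc] with w hw
        obtain ⟨v, hv⟩ := exists_moebius_neg_swap hx hw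
        have h := lintegral_circle_mul_left v fun u => H ((u : ℂ) * moebius (-x) w)
        rw [← h, hv]
        refine lintegral_congr fun u => ?_
        rw [Circle.coe_mul, mul_left_comm, mul_assoc]
    _ = ∫⁻ u : Circle, ∫⁻ w, H ((u : ℂ) * moebius (-x) w) ∂moebiusMeasure ∂circleMeasure :=
        lintegral_lintegral_swap hm3.aemeasurable
    _ = ∫⁻ _ : Circle, ∫⁻ w, H w ∂moebiusMeasure ∂circleMeasure := by
        refine lintegral_congr fun u => ?_
        rw [(measurePreserving_moebius (neg_mem_disc hx)).lintegral_comp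
          (f := fun w => H ((u : ℂ) * w)) (by fun_prop),
          (measurePreserving_circle_mul u).lintegral_comp hH]
    _ = ∫⁻ w, H w ∂moebiusMeasure := by simp

/-- The Möbius map `φ_{-w}` sends points near the origin to points near `w`, in the Euclidean metric
and uniformly in `w`. -/
theorem norm_moebius_neg_sub_le {w x : ℂ} (hw : w ∈ disc) (hx : x ∈ disc) :
    ‖moebius (-w) x - w‖ ≤ 2 * ‖x‖ := by
  have h1 := one_sub_conj_mul_ne_zero (neg_mem_disc hw) hx
  have h2 : moebius (-w) x - w = x * (1 - (‖w‖ : ℂ) ^ 2) / (1 - conj (-w) * x) := by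
    rw [moebius, eq_div_iff h1, sub_mul, div_mul_cancel₀ _ h1, ← Complex.mul_conj', map_neg]
    ring
  have h3 : ‖(1 : ℂ) - (‖w‖ : ℂ) ^ 2‖ = 1 - ‖w‖ ^ 2 := by
    have : (1 : ℂ) - (‖w‖ : ℂ) ^ 2 = ((1 - ‖w‖ ^ 2 : ℝ) : ℂ) := by push_cast; rfl
    rw [this, Complex.norm_real, Real.norm_of_nonneg (one_sub_sq_pos hw).le]
  have h4 : 1 - ‖w‖ ≤ ‖1 - conj (-w) * x‖ := by
    have h5 : ‖conj (-w) * x‖ ≤ ‖w‖ := by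
      rw [mem_disc] at hx
      rw [norm_mul, RCLike.norm_conj, norm_neg]
      exact mul_le_of_le_one_right (norm_nonneg _) hx.le
    have := norm_sub_norm_le 1 (conj (-w) * x)
    rw [norm_one] at this
    linarith
  rw [h2, norm_div, norm_mul, h3, div_le_iff₀ (norm_pos_iff.2 h1)]
  rw [mem_disc] at hw
  nlinarith [norm_nonneg x, norm_nonneg w, mul_nonneg (norm_nonneg x) (norm_nonneg w),
    mul_le_mul_of_nonneg_left h4 (norm_nonneg x),
    mul_nonneg (norm_nonneg x) (mul_nonneg (sub_nonneg.2 hw.le) (sub_nonneg.2 hw.le))]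

/-! ### Weighted Bergman measures and unitarity of the Möbius shifts -/

theorem measurable_bergmanDensity (α : ℝ) :
    Measurable fun z : ℂ => ENNReal.ofReal ((α + 1) * (1 - ‖z‖ ^ 2) ^ (α + 2)) := by
  fun_prop

theorem bergmanMeasure_eq_withDensity (α : ℝ) :
    bergmanMeasure α = moebiusMeasure.withDensity
      fun z => ENNReal.ofReal ((α + 1) * (1 - ‖z‖ ^ 2) ^ (α + 2)) := by
  rw [moebiusMeasure, ← withDensity_mul _ measurable_moebiusDensity (measurable_bergmanDensity α),
    bergmanMeasure]
  refine withDensity_congr_ae ?_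
  filter_upwards [ae_restrict_mem measurableSet_disc] with z hz
  have h1 := one_sub_sq_pos hz
  rw [Pi.mul_apply, ← ENNReal.ofReal_mul (by positivity), Real.rpow_add h1]
  congr 1
  have : (1 - ‖z‖ ^ 2) ^ (2 : ℝ) = (1 - ‖z‖ ^ 2) ^ 2 := by norm_cast
  rw [this]
  field_simp

instance (α : ℝ) : SigmaFinite (bergmanMeasure α) := by
  unfold bergmanMeasure
  exact SigmaFinite.withDensity_of_ne_top (ae_of_all _ fun z => ENNReal.ofReal_ne_top)

theorem ae_bergmanMeasure_mem_disc (α : ℝ) : ∀ᵐ z ∂(bergmanMeasure α), z ∈ disc :=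
  (withDensity_absolutelyContinuous _ _).ae_le (ae_restrict_mem measurableSet_disc)

theorem lintegral_bergmanMeasure (α : ℝ) {g : ℂ → ℝ≥0∞} (hg : Measurable g) :
    ∫⁻ z, g z ∂(bergmanMeasure α)
      = ∫⁻ z, ENNReal.ofReal ((α + 1) * (1 - ‖z‖ ^ 2) ^ (α + 2)) * g z ∂moebiusMeasure := by
  rw [bergmanMeasure_eq_withDensity α,
    lintegral_withDensity_eq_lintegral_mul _ (measurable_bergmanDensity α) hg]
  rfl

/-- The function `(1 - |ζ|²)^(α + 2) |h(ζ)|²`, whose integral with respect to the Möbius measure is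
`‖h‖² / (α + 1)`, and which the Möbius shift of `h` transports along the Möbius map. -/
def invariantDensity (α : ℝ) (h : ℂ → ℂ) (ζ : ℂ) : ℝ≥0∞ :=
  ENNReal.ofReal ((1 - ‖ζ‖ ^ 2) ^ (α + 2)) * ‖h ζ‖ₑ ^ 2

theorem measurable_invariantDensity (α : ℝ) {h : ℂ → ℂ} (hh : Measurable h) :
    Measurable (invariantDensity α h) := by
  unfold invariantDensity; fun_prop

theorem lintegral_mul_normSq_bergmanMeasure {α : ℝ} (hα : -1 < α) {g : ℂ → ℝ≥0∞}
    (hg : Measurable g) {h : ℂ → ℂ} (hh : Measurable h) :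
    ∫⁻ z, g z * ‖h z‖ₑ ^ 2 ∂(bergmanMeasure α)
      = ENNReal.ofReal (α + 1) * ∫⁻ z, g z * invariantDensity α h z ∂moebiusMeasure := by
  rw [lintegral_bergmanMeasure α (by fun_prop),
    ← lintegral_const_mul (f := fun z => g z * invariantDensity α h z) _
      (hg.mul (measurable_invariantDensity α hh))]
  refine lintegral_congr fun z => ?_
  rw [ENNReal.ofReal_mul (by linarith), invariantDensity]
  ring

/-- The base of the principal power in `U_z` avoids the closed negative axis, since it is a positive
multiple of the inverse square of a number with positive real part. -/
theorem moebiusDeriv_mem_slitPlane {z ζ : ℂ} (hz : z ∈ disc) (hζ : ζ ∈ disc) :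
    moebiusDeriv z ζ ∈ Complex.slitPlane := by
  have hc := one_sub_sq_pos hz
  have hq := re_one_sub_conj_mul_pos hz hζ
  set q := 1 - conj z * ζ with hqdef
  have hq0 : q ≠ 0 := one_sub_conj_mul_ne_zero hz hζ
  have hp : 0 < (q⁻¹).re := by
    rw [Complex.inv_re]; exact div_pos hq (Complex.normSq_pos.2 hq0)
  have hD : moebiusDeriv z ζ = ((1 - ‖z‖ ^ 2 : ℝ) : ℂ) * (q⁻¹) ^ 2 := by
    rw [moebiusDeriv, inv_pow, div_eq_mul_inv]; push_cast; rfl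
  rw [hD, Complex.mem_slitPlane_iff, Complex.re_ofReal_mul, Complex.im_ofReal_mul,
    sq (q⁻¹), Complex.mul_re, Complex.mul_im]
  by_cases him : (q⁻¹).im = 0
  · left; rw [him]; simp only [mul_zero, sub_zero]; positivity
  · right
    have : (q⁻¹).re * (q⁻¹).im ≠ 0 := mul_ne_zero hp.ne' him
    intro h
    rcases mul_eq_zero.1 h with h | h
    · exact hc.ne' h
    · exact this (by linarith)

theorem moebiusShift_apply (α : ℝ) (z : ℂ) (h : ℂ → ℂ) (ζ : ℂ) :
    moebiusShift α z h ζ = h (moebius z ζ) * moebiusDeriv z ζ ^ (((2 + α) / 2 : ℝ) : ℂ) := rfl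

theorem invariantDensity_moebiusShift (α : ℝ) (h : ℂ → ℂ) {z ζ : ℂ} (hz : z ∈ disc)
    (hζ : ζ ∈ disc) :
    invariantDensity α (moebiusShift α z h) ζ = invariantDensity α h (moebius z ζ) := by
  have h1 := one_sub_sq_pos hζ
  have h2 : ‖moebiusDeriv z ζ ^ (((2 + α) / 2 : ℝ) : ℂ)‖ₑ ^ 2
      = ENNReal.ofReal (‖moebiusDeriv z ζ‖ ^ (α + 2)) := by
    rw [← ofReal_norm, ← ENNReal.ofReal_pow (norm_nonneg _), Complex.norm_cpow_real,
      ← Real.rpow_natCast, ← Real.rpow_mul (norm_nonneg _)]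
    congr 2
    push_cast; ring
  rw [invariantDensity, invariantDensity, moebiusShift_apply, one_sub_norm_moebius_sq hz hζ,
    Real.mul_rpow h1.le (norm_nonneg _), ENNReal.ofReal_mul (by positivity), enorm_mul, mul_pow, h2]
  ring

theorem measurable_moebiusShift_rotate_uncurry (α : ℝ) {h : ℂ → ℂ} (hh : Measurable h) :
    Measurable fun q : (Circle × ℂ) × ℂ => moebiusShift α q.1.2 (rotate q.1.1 h) q.2 := by
  have h1 : Measurable fun q : (Circle × ℂ) × ℂ => moebius q.1.2 q.2 :=
    measurable_moebius_uncurry.comp (f := fun q : (Circle × ℂ) × ℂ => (q.1.2, q.2)) (by fun_prop)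
  have h2 : Measurable fun q : (Circle × ℂ) × ℂ => moebiusDeriv q.1.2 q.2 :=
    measurable_moebiusDeriv_uncurry.comp (f := fun q : (Circle × ℂ) × ℂ => (q.1.2, q.2))
      (by fun_prop)
  have h3 : Measurable fun q : (Circle × ℂ) × ℂ => (q.1.1 : ℂ) :=
    measurable_circle_coe.comp (by fun_prop)
  exact (hh.comp (h3.mul h1)).mul (h2.pow_const _)

theorem measurable_moebiusShift_uncurry (α : ℝ) {h : ℂ → ℂ} (hh : Measurable h) :
    Measurable fun q : ℂ × ℂ => moebiusShift α q.1 h q.2 :=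
  (hh.comp measurable_moebius_uncurry).mul (measurable_moebiusDeriv_uncurry.pow_const _)

theorem measurable_moebiusShift (α : ℝ) (z : ℂ) {h : ℂ → ℂ} (hh : Measurable h) :
    Measurable (moebiusShift α z h) :=
  (measurable_moebiusShift_uncurry α hh).comp (measurable_const.prodMk measurable_id)

theorem measurable_rotate (u : Circle) {h : ℂ → ℂ} (hh : Measurable h) :
    Measurable (rotate u h) := by
  unfold rotate; fun_prop

/-- The Möbius shifts are unitary, and they move the mass distribution of `h` by `φ_{-z}`. -/
theorem lintegral_normSq_moebiusShift {α : ℝ} (hα : -1 < α) {z : ℂ} (hz : z ∈ disc)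
    {h : ℂ → ℂ} (hh : Measurable h) {g : ℂ → ℝ≥0∞} (hg : Measurable g) :
    ∫⁻ ζ, g ζ * ‖moebiusShift α z h ζ‖ₑ ^ 2 ∂(bergmanMeasure α)
      = ∫⁻ ζ, g (moebius (-z) ζ) * ‖h ζ‖ₑ ^ 2 ∂(bergmanMeasure α) := by
  have hz' := neg_mem_disc hz
  have hg' : Measurable fun ζ => g (moebius (-z) ζ) := hg.comp (measurable_moebius _)
  rw [lintegral_mul_normSq_bergmanMeasure hα hg (measurable_moebiusShift α z hh),
    lintegral_mul_normSq_bergmanMeasure hα hg' hh]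
  congr 1
  rw [← (measurePreserving_moebius hz).lintegral_comp
    (f := fun ζ => g (moebius (-z) ζ) * invariantDensity α h ζ)
    (hg'.mul (measurable_invariantDensity α hh))]
  refine lintegral_congr_ae ?_
  filter_upwards [ae_mem_disc] with ζ hζ
  rw [invariantDensity_moebiusShift α h hz hζ, moebius_neg_moebius hz hζ]

theorem lintegral_normSq_rotate (α : ℝ) (u : Circle)
    {h : ℂ → ℂ} (hh : Measurable h) {g : ℝ → ℝ≥0∞} (hg : Measurable g) :
    ∫⁻ ζ, g ‖ζ‖ * ‖h (u * ζ)‖ₑ ^ 2 ∂(bergmanMeasure α)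
      = ∫⁻ ζ, g ‖ζ‖ * ‖h ζ‖ₑ ^ 2 ∂(bergmanMeasure α) := by
  rw [lintegral_bergmanMeasure α (by fun_prop), lintegral_bergmanMeasure α (by fun_prop),
    ← (measurePreserving_circle_mul u).lintegral_comp (f := fun z =>
      ENNReal.ofReal ((α + 1) * (1 - ‖z‖ ^ 2) ^ (α + 2)) * (g ‖z‖ * ‖h z‖ₑ ^ 2)) (by fun_prop)]
  simp_rw [norm_mul, Circle.norm_coe, one_mul]

theorem bergmanInner_eq_integral_moebiusMeasure {α : ℝ} (hα : -1 < α) (F G : ℂ → ℂ) :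
    bergmanInner α F G = ∫ ζ, (((α + 1) * (1 - ‖ζ‖ ^ 2) ^ (α + 2) : ℝ) : ℂ) * (F ζ * conj (G ζ))
      ∂moebiusMeasure := by
  rw [bergmanInner, bergmanMeasure_eq_withDensity α,
    integral_withDensity_eq_integral_toReal_smul (measurable_bergmanDensity α)
      (ae_of_all _ fun z => ENNReal.ofReal_lt_top)]
  refine integral_congr_ae ?_
  filter_upwards [ae_mem_disc] with ζ hζ
  have h1 := one_sub_sq_pos hζ
  have h2 : 0 < α + 1 := by linarith
  rw [ENNReal.toReal_ofReal (by positivity), Complex.real_smul]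

/-- The adjoint of the Möbius shift `U_w` is `U_{-w}`. -/
theorem bergmanInner_moebiusShift_right {α : ℝ} (hα : -1 < α) {w : ℂ} (hw : w ∈ disc)
    {h g : ℂ → ℂ} (hh : Measurable h) (hg : Measurable g) :
    bergmanInner α h (moebiusShift α w g) = bergmanInner α (moebiusShift α (-w) h) g := by
  have hw' := neg_mem_disc hw
  rw [bergmanInner_eq_integral_moebiusMeasure hα, bergmanInner_eq_integral_moebiusMeasure hα]
  conv_lhs => rw [← (measurePreserving_moebius hw').map_eq]
  rw [integral_map (measurable_moebius _).aemeasurable]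
  · refine integral_congr_ae ?_
    filter_upwards [ae_mem_disc] with ξ hξ
    have hD := moebiusDeriv_ne_zero hw' hξ
    have harg := Complex.slitPlane_arg_ne_pi (moebiusDeriv_mem_slitPlane hw' hξ)
    set D := moebiusDeriv (-w) ξ with hDdef
    have hs : (‖D‖ ^ (α + 2) : ℝ)
        = ‖D ^ (((2 + α) / 2 : ℝ) : ℂ)‖ ^ 2 := by
      rw [Complex.norm_cpow_real, ← Real.rpow_natCast, ← Real.rpow_mul (norm_nonneg _)]
      congr 1
      push_cast; ring
    have hcp : D ^ (((2 + α) / 2 : ℝ) : ℂ) ≠ 0 := by simp [Complex.cpow_eq_zero_iff, hD]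
    rw [moebiusShift_apply, moebiusShift_apply, moebius_moebius_neg hw hξ,
      moebiusDeriv_moebius_neg hw hξ, ← hDdef, Complex.inv_cpow _ _ harg,
      one_sub_norm_moebius_sq hw' hξ, ← hDdef,
      Real.mul_rpow (one_sub_sq_pos hξ).le (norm_nonneg _), hs]
    push_cast
    rw [← Complex.mul_conj', map_mul, map_inv₀]
    have hcp' : conj (D ^ ((((2 + α) / 2 : ℝ)) : ℂ)) ≠ 0 := by simpa using hcp
    push_cast at hcp hcp'
    field_simp
  · have h1 : Measurable fun ζ => conj (moebiusShift α w g ζ) :=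
      Complex.continuous_conj.measurable.comp (measurable_moebiusShift α w hg)
    exact Measurable.aestronglyMeasurable (by fun_prop)

theorem bergmanInner_conj_symm (α : ℝ) (F G : ℂ → ℂ) :
    bergmanInner α F G = conj (bergmanInner α G F) := by
  rw [bergmanInner, bergmanInner, ← integral_conj]
  congr 1
  ext ζ
  simp [mul_comm]

theorem differentiableOn_moebiusShift (α : ℝ) {z : ℂ} (hz : z ∈ disc) {h : ℂ → ℂ}
    (hh : DifferentiableOn ℂ h disc) : DifferentiableOn ℂ (moebiusShift α z h) disc := by
  have h1 : DifferentiableOn ℂ (moebius z) disc := fun ζ hζ =>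
    (hasDerivAt_moebius hz hζ).differentiableAt.differentiableWithinAt
  refine (hh.comp h1 fun ζ hζ => moebius_mem_disc hz hζ).mul ?_
  intro ζ hζ
  refine DifferentiableWithinAt.cpow ?_ (differentiableWithinAt_const _)
    (moebiusDeriv_mem_slitPlane hz hζ)
  exact (differentiableWithinAt_const _).div (by fun_prop)
    (pow_ne_zero 2 (one_sub_conj_mul_ne_zero hz hζ))

/-! ### Moments of the weighted Bergman measures -/

/-- The number `Γ(n + α + 2) / (n! Γ(α + 2))`, the reciprocal of the squared norm of `ζ ^ n` in the
weighted Bergman space. -/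
def coeffWeight (α : ℝ) (n : ℕ) : ℝ :=
  Real.Gamma ((n : ℝ) + α + 2) / ((n.factorial : ℝ) * Real.Gamma (α + 2))

theorem coeffWeight_pos {α : ℝ} (hα : -1 < α) (n : ℕ) : 0 < coeffWeight α n := by
  have h1 : 0 < Real.Gamma ((n : ℝ) + α + 2) :=
    Real.Gamma_pos_of_pos (by have := n.cast_nonneg (α := ℝ); linarith)
  have h2 : 0 < Real.Gamma (α + 2) := Real.Gamma_pos_of_pos (by linarith)
  unfold coeffWeight; positivity

theorem coeffWeight_zero {α : ℝ} (hα : -1 < α) : coeffWeight α 0 = 1 := by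
  have h2 : 0 < Real.Gamma (α + 2) := Real.Gamma_pos_of_pos (by linarith)
  simp [coeffWeight, h2.ne']

theorem coeffWeight_succ {α : ℝ} (hα : -1 < α) (n : ℕ) :
    coeffWeight α (n + 1) = coeffWeight α n * ((α + 2 + n) / (n + 1)) := by
  have h0 : (0 : ℝ) ≤ n := n.cast_nonneg
  have h2 : 0 < Real.Gamma (α + 2) := Real.Gamma_pos_of_pos (by linarith)
  have h3 : ((n + 1 : ℕ) : ℝ) + α + 2 = ((n : ℝ) + α + 2) + 1 := by push_cast; ring
  rw [coeffWeight, coeffWeight, h3, Real.Gamma_add_one (by linarith), Nat.factorial_succ]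
  push_cast
  field_simp
  ring

theorem coeffWeight_zero_left (n : ℕ) : coeffWeight 0 n = n + 1 := by
  induction n with
  | zero => simp [coeffWeight_zero]
  | succ k ih =>
    rw [coeffWeight_succ (by norm_num), ih]
    push_cast
    field_simp
    ring

theorem coeffWeight_eq_choose {α : ℝ} (hα : -1 < α) (n : ℕ) :
    coeffWeight α n = Ring.choose (α + 2 + n - 1) n := by
  have h : (n.factorial : ℝ) * Ring.choose (α + 2 + n - 1) n
      = (ascPochhammer ℕ n).smeval (α + 2) := by
    rw [← Ring.factorial_nsmul_multichoose_eq_ascPochhammer, nsmul_eq_mul, Ring.choose]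
    congr 2
    ring
  have h2 : (n.factorial : ℝ) * coeffWeight α n = (ascPochhammer ℕ n).smeval (α + 2) := by
    induction n with
    | zero => simp [coeffWeight_zero hα]
    | succ k ih =>
      rw [ascPochhammer_succ_right, Polynomial.smeval_mul, ← ih, coeffWeight_succ hα,
        Nat.factorial_succ]
      · push_cast
        simp only [Polynomial.smeval_add, Polynomial.smeval_X, Polynomial.smeval_natCast, pow_zero,
          pow_one, nsmul_eq_mul, mul_one]
        field_simp
      · rw [← Ring.factorial_nsmul_multichoose_eq_ascPochhammer, nsmul_eq_mul, Ring.choose]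
        congr 2
        ring
  have h3 : (n.factorial : ℝ) ≠ 0 := by positivity
  exact mul_left_cancel₀ h3 (h2.trans h.symm)

/-- The binomial series. -/
theorem hasSum_coeffWeight {α : ℝ} (hα : -1 < α) {x : ℝ} (hx : |x| < 1) :
    HasSum (fun n => coeffWeight α n * x ^ n) ((1 - x) ^ (-(α + 2))) := by
  have h := (Real.one_div_one_sub_rpow_hasFPowerSeriesOnBall_zero (α + 2)).hasSum (y := x)
    (by simpa [enorm_eq_nnnorm, ← NNReal.coe_lt_one] using hx)
  rw [zero_add, one_div, ← Real.rpow_neg (by linarith [(abs_lt.1 hx).2])] at h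
  simp only [FormalMultilinearSeries.ofScalars_apply_eq, smul_eq_mul] at h
  simp only [coeffWeight_eq_choose hα]
  exact h

theorem lintegral_norm_complex (g : ℝ → ℝ≥0∞) (hg : Measurable g) :
    ∫⁻ z : ℂ, g ‖z‖ = ENNReal.ofReal (2 * Real.pi) *
      ∫⁻ r in Set.Ioi (0 : ℝ), ENNReal.ofReal r * g r := by
  rw [← Complex.lintegral_comp_polarCoord_symm, polarCoord_target]
  simp only [Complex.norm_polarCoord_symm, smul_eq_mul]
  have hm : Measurable fun p : ℝ × ℝ => ENNReal.ofReal p.1 * g |p.1| := by fun_prop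
  rw [Measure.volume_eq_prod, ← Measure.prod_restrict, lintegral_prod _ hm.aemeasurable,
    ← lintegral_const_mul' _ _ ENNReal.ofReal_ne_top]
  refine setLIntegral_congr_fun measurableSet_Ioi fun r hr => ?_
  have hr' : 0 < r := hr
  simp only [lintegral_const, Measure.restrict_apply_univ, Real.volume_Ioo, abs_of_pos hr']
  rw [mul_comm]
  congr 2
  ring

theorem lintegral_pow_mul_one_sub_rpow {α : ℝ} (hα : -1 < α) (n : ℕ) :
    ∫⁻ s in Set.Ioo (0 : ℝ) 1, ENNReal.ofReal ((α + 1) * (1 - s) ^ α * s ^ n)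
      = ENNReal.ofReal (coeffWeight α n)⁻¹ := by
  have h1 : (0 : ℝ) < (n : ℝ) + 1 := by positivity
  have h2 : 0 < α + 1 := by linarith
  have h3 := ProbabilityTheory.lintegral_betaPDF_eq_one h1 h2
  rw [ProbabilityTheory.lintegral_betaPDF] at h3
  have hb := ProbabilityTheory.beta_pos h1 h2
  have hw : (coeffWeight α n)⁻¹ = (α + 1) * ProbabilityTheory.beta ((n : ℝ) + 1) (α + 1) := by
    rw [coeffWeight, ProbabilityTheory.beta, Real.Gamma_nat_eq_factorial,
      show α + 2 = (α + 1) + 1 by ring, Real.Gamma_add_one h2.ne',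
      show (n : ℝ) + 1 + (α + 1) = n + α + 2 by ring, inv_div]
    ring
  rw [hw, ← mul_one (ENNReal.ofReal _), ← h3, ← lintegral_const_mul _ (by fun_prop)]
  refine setLIntegral_congr_fun measurableSet_Ioo fun s hs => ?_
  rw [← ENNReal.ofReal_mul (by positivity)]
  congr 1
  rw [add_sub_cancel_right, add_sub_cancel_right, Real.rpow_natCast]
  field_simp

/-- The moments of the weighted Bergman measure, by polar coordinates and the Beta integral. -/
theorem lintegral_norm_pow_bergmanMeasure {α : ℝ} (hα : -1 < α) (n : ℕ) :
    ∫⁻ ζ, ‖ζ‖ₑ ^ (2 * n) ∂(bergmanMeasure α) = ENNReal.ofReal (coeffWeight α n)⁻¹ := by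
  have hd : Measurable fun z : ℂ => ENNReal.ofReal ((α + 1) / Real.pi * (1 - ‖z‖ ^ 2) ^ α) := by
    fun_prop
  rw [bergmanMeasure, lintegral_withDensity_eq_lintegral_mul _ hd (by fun_prop),
    ← lintegral_indicator measurableSet_disc]
  have h1 (z : ℂ) : disc.indicator
      ((fun z : ℂ => ENNReal.ofReal ((α + 1) / Real.pi * (1 - ‖z‖ ^ 2) ^ α)) *
        fun ζ : ℂ => ‖ζ‖ₑ ^ (2 * n)) z
      = (Set.Iio (1 : ℝ)).indicator (fun r => ENNReal.ofReal ((α + 1) / Real.pi * (1 - r ^ 2) ^ α) *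
        ENNReal.ofReal r ^ (2 * n)) ‖z‖ := by
    by_cases hz : z ∈ disc
    · rw [Set.indicator_of_mem hz, Set.indicator_of_mem (Set.mem_Iio.2 (mem_disc.1 hz)),
        Pi.mul_apply, ofReal_norm]
    · rw [Set.indicator_of_notMem hz,
        Set.indicator_of_notMem (fun h => hz (mem_disc.2 (Set.mem_Iio.1 h)))]
  simp_rw [h1]
  rw [lintegral_norm_complex _ ((by fun_prop : Measurable _).indicator measurableSet_Iio),
    ← lintegral_pow_mul_one_sub_rpow hα n]
  -- the substitution `s = r ^ 2`
  have himg : (fun r : ℝ => r ^ 2) '' Set.Ioo 0 1 = Set.Ioo 0 1 := by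
    ext s
    constructor
    · rintro ⟨r, ⟨h0, h1⟩, rfl⟩
      exact ⟨by positivity, by dsimp only; nlinarith⟩
    · rintro ⟨h0, h1⟩
      exact ⟨√s, ⟨Real.sqrt_pos.2 h0, by rw [Real.sqrt_lt' one_pos]; simpa using h1⟩,
        Real.sq_sqrt h0.le⟩
  have hinj : Set.InjOn (fun r : ℝ => r ^ 2) (Set.Ioo 0 1) := fun a ha b hb h =>
    (pow_left_inj₀ ha.1.le hb.1.le two_ne_zero).1 h
  have hsub := lintegral_image_eq_lintegral_abs_deriv_mul (f := fun r : ℝ => r ^ 2)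
    (f' := fun r => 2 * r) measurableSet_Ioo
    (fun x _ => by simpa using (hasDerivAt_pow 2 x).hasDerivWithinAt) hinj
    (fun s => ENNReal.ofReal ((α + 1) * (1 - s) ^ α * s ^ n))
  rw [himg] at hsub
  rw [hsub, ← lintegral_const_mul' _ _ ENNReal.ofReal_ne_top,
    ← lintegral_indicator measurableSet_Ioi, ← lintegral_indicator measurableSet_Ioo]
  refine lintegral_congr fun r => ?_
  by_cases h0 : 0 < r
  · by_cases h1 : r < 1
    · have h2 : 0 < 1 - r ^ 2 := by nlinarith
      have h3 : 0 < α + 1 := by linarith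
      have h4 := Real.rpow_nonneg h2.le α
      rw [Set.indicator_of_mem (Set.mem_Ioi.2 h0), Set.indicator_of_mem (Set.mem_Iio.2 h1),
        Set.indicator_of_mem (Set.mem_Ioo.2 ⟨h0, h1⟩), abs_of_pos (by positivity),
        ← ENNReal.ofReal_pow h0.le, ← ENNReal.ofReal_mul (by positivity),
        ← ENNReal.ofReal_mul (by positivity), ← ENNReal.ofReal_mul (by positivity),
        ← ENNReal.ofReal_mul (by positivity)]
      congr 1
      field_simp
      ring
    · rw [Set.indicator_of_mem (Set.mem_Ioi.2 h0),
        Set.indicator_of_notMem (fun h => h1 (Set.mem_Iio.1 h)),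
        Set.indicator_of_notMem (fun h => h1 h.2), mul_zero, mul_zero]
  · rw [Set.indicator_of_notMem (fun h => h0 (Set.mem_Ioi.1 h)),
      Set.indicator_of_notMem (fun h => h0 h.1)]

theorem integrable_norm_pow_bergmanMeasure {α : ℝ} (hα : -1 < α) (n : ℕ) :
    Integrable (fun ζ : ℂ => ‖ζ‖ ^ (2 * n)) (bergmanMeasure α) := by
  refine ⟨by fun_prop, ?_⟩
  rw [HasFiniteIntegral]
  simp only [enorm_pow, enorm_norm]
  rw [lintegral_norm_pow_bergmanMeasure hα]
  exact ENNReal.ofReal_lt_top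

theorem integral_norm_pow_bergmanMeasure {α : ℝ} (hα : -1 < α) (n : ℕ) :
    ∫ ζ : ℂ, ‖ζ‖ ^ (2 * n) ∂(bergmanMeasure α) = (coeffWeight α n)⁻¹ := by
  rw [integral_eq_lintegral_of_nonneg_ae (ae_of_all _ fun _ => by positivity) (by fun_prop)]
  simp only [ENNReal.ofReal_pow (norm_nonneg _), ofReal_norm]
  rw [lintegral_norm_pow_bergmanMeasure hα,
    ENNReal.toReal_ofReal (inv_nonneg.2 (coeffWeight_pos hα n).le)]

/-! ### Power series in the weighted Bergman space -/

/-- `F` is the sum of the power series with coefficients `a` on the open unit disc. -/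
def HasDiscSeries (a : ℕ → ℂ) (F : ℂ → ℂ) : Prop :=
  ∀ z ∈ disc, HasSum (fun n => a n * z ^ n) (F z)

theorem hasDiscSeries_taylorCoeff {F : ℂ → ℂ} (hF : DifferentiableOn ℂ F disc) :
    HasDiscSeries (taylorCoeff F) F := by
  intro z hz
  have h := Complex.hasSum_taylorSeries_on_ball hF hz
  convert! h using 2 with n
  rw [taylorCoeff, sub_zero, smul_eq_mul, smul_eq_mul]
  ring

theorem hasDiscSeries_pow (m : ℕ) : HasDiscSeries (Pi.single m 1) fun z => z ^ m := by
  intro z _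
  have h := hasSum_single (f := fun n => (Pi.single m 1 : ℕ → ℂ) n * z ^ n) m
    fun n hn => by simp [hn]
  simpa using h

namespace HasDiscSeries

variable {a b : ℕ → ℂ} {F G : ℂ → ℂ}

theorem summable_norm (hF : HasDiscSeries a F) {z : ℂ} (hz : z ∈ disc) :
    Summable fun n => ‖a n * z ^ n‖ := (hF z hz).summable.norm

theorem rotate (hF : HasDiscSeries a F) (u : Circle) :
    HasDiscSeries (fun n => a n * (u : ℂ) ^ n) (rotate u F) := by
  intro z hz
  have h := hF _ ((circle_mul_mem_disc u).2 hz)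
  simp only [mul_pow, ← mul_assoc] at h
  exact h

theorem congr (hF : HasDiscSeries a F) (h : ∀ z ∈ disc, G z = F z) : HasDiscSeries a G :=
  fun z hz => by rw [h z hz]; exact hF z hz

theorem apply_circle_mul (hF : HasDiscSeries a F) {ζ : ℂ} (hζ : ζ ∈ disc) (u : Circle) :
    F (u * ζ) = ∑' n, (a n * ζ ^ n) * (u : ℂ) ^ n := by
  rw [← (hF _ ((circle_mul_mem_disc u).2 hζ)).tsum_eq]
  congr 1
  ext n
  ring

theorem differentiableOn (hF : HasDiscSeries a F) : DifferentiableOn ℂ F disc := by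
  have hr : 1 ≤ (FormalMultilinearSeries.ofScalars ℂ a).radius := by
    refine ENNReal.le_of_forall_nnreal_lt fun r hr => ?_
    refine FormalMultilinearSeries.le_radius_of_summable_norm _ ?_
    have hr' : ((r : ℝ) : ℂ) ∈ disc := by
      rw [mem_disc]
      simpa using hr
    refine (hF.summable_norm hr').congr fun n => ?_
    simp
  have h : HasFPowerSeriesOnBall F (FormalMultilinearSeries.ofScalars ℂ a) 0 1 := by
    refine ⟨hr, one_pos, fun {y} hy => ?_⟩
    have hy' : y ∈ disc := by simpa [mem_disc, enorm_eq_nnnorm, ← NNReal.coe_lt_one] using hy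
    have := hF y hy'
    simpa only [zero_add, FormalMultilinearSeries.ofScalars_apply_eq, smul_eq_mul] using this
  have h2 := h.differentiableOn
  refine h2.mono fun y hy => ?_
  simpa [mem_disc, enorm_eq_nnnorm, ← NNReal.coe_lt_one] using hy

theorem lintegral_circle (hF : HasDiscSeries a F) {ζ : ℂ} (hζ : ζ ∈ disc) :
    ∫⁻ u : Circle, ‖F (u * ζ)‖ₑ ^ 2 ∂circleMeasure = ∑' n, ‖a n‖ₑ ^ 2 * ‖ζ‖ₑ ^ (2 * n) := by
  simp_rw [hF.apply_circle_mul hζ]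
  rw [lintegral_circle_series (hF.summable_norm hζ)]
  simp_rw [enorm_mul, enorm_pow, mul_pow, ← pow_mul, mul_comm 2]

/-- Parseval's identity on each circle, integrated against a radial weight. Distinct powers are
orthogonal on every circle, so no cross terms appear. -/
theorem lintegral_radial_mul (hF : HasDiscSeries a F) (hFm : Measurable F) (α : ℝ) {g : ℝ → ℝ≥0∞}
    (hg : Measurable g) :
    ∫⁻ ζ, g ‖ζ‖ * ‖F ζ‖ₑ ^ 2 ∂(bergmanMeasure α)
      = ∑' n, ‖a n‖ₑ ^ 2 * ∫⁻ ζ, g ‖ζ‖ * ‖ζ‖ₑ ^ (2 * n) ∂(bergmanMeasure α) := by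
  have hm : Measurable fun q : Circle × ℂ => g ‖q.2‖ * ‖F (q.1 * q.2)‖ₑ ^ 2 := by
    have h1 : Measurable fun q : Circle × ℂ => (q.1 : ℂ) :=
      measurable_circle_coe.comp measurable_fst
    fun_prop
  calc ∫⁻ ζ, g ‖ζ‖ * ‖F ζ‖ₑ ^ 2 ∂(bergmanMeasure α)
      = ∫⁻ u : Circle, ∫⁻ ζ, g ‖ζ‖ * ‖F (u * ζ)‖ₑ ^ 2 ∂(bergmanMeasure α) ∂circleMeasure := by
        simp_rw [lintegral_normSq_rotate α _ hFm hg]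
        simp
    _ = ∫⁻ ζ, ∫⁻ u : Circle, g ‖ζ‖ * ‖F (u * ζ)‖ₑ ^ 2 ∂circleMeasure ∂(bergmanMeasure α) :=
        lintegral_lintegral_swap hm.aemeasurable
    _ = ∫⁻ ζ, ∑' n, ‖a n‖ₑ ^ 2 * (g ‖ζ‖ * ‖ζ‖ₑ ^ (2 * n)) ∂(bergmanMeasure α) := by
        refine lintegral_congr_ae ?_
        filter_upwards [ae_bergmanMeasure_mem_disc α] with ζ hζ
        have hc : Measurable fun u : Circle => ‖F (u * ζ)‖ₑ ^ 2 := by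
          have := measurable_circle_coe
          fun_prop
        rw [lintegral_const_mul _ hc, hF.lintegral_circle hζ, ← ENNReal.tsum_mul_left]
        congr 1
        ext n
        ring
    _ = _ := by
        rw [lintegral_tsum fun n => by fun_prop]
        congr 1
        ext n
        rw [lintegral_const_mul _ (by fun_prop)]

/-- The norm of the weighted Bergman space in terms of the coefficients. -/
theorem lintegral_normSq (hF : HasDiscSeries a F) (hFm : Measurable F) {α : ℝ} (hα : -1 < α) :
    ∫⁻ ζ, ‖F ζ‖ₑ ^ 2 ∂(bergmanMeasure α)
      = ∑' n, ‖a n‖ₑ ^ 2 * ENNReal.ofReal (coeffWeight α n)⁻¹ := by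
  have h := hF.lintegral_radial_mul hFm α (g := fun _ => 1) measurable_const
  simpa only [one_mul, lintegral_norm_pow_bergmanMeasure hα] using h

theorem summable_normSq (hF : HasDiscSeries a F) (hFm : Measurable F) {α : ℝ} (hα : -1 < α)
    (hfin : ∫⁻ ζ, ‖F ζ‖ₑ ^ 2 ∂(bergmanMeasure α) ≠ ∞) :
    Summable fun n => ‖a n‖ ^ 2 * (coeffWeight α n)⁻¹ := by
  rw [hF.lintegral_normSq hFm hα] at hfin
  have h := ENNReal.summable_toReal hfin
  refine h.congr fun n => ?_
  rw [ENNReal.toReal_mul, ENNReal.toReal_pow, toReal_enorm,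
    ENNReal.toReal_ofReal (inv_nonneg.2 (coeffWeight_pos hα n).le)]

end HasDiscSeries

theorem measurePreserving_circle_mul_bergmanMeasure (α : ℝ) (u : Circle) :
    MeasurePreserving (fun z : ℂ => (u : ℂ) * z) (bergmanMeasure α) (bergmanMeasure α) := by
  have hm : Measurable fun z : ℂ => (u : ℂ) * z := by fun_prop
  refine ⟨hm, Measure.ext_of_lintegral _ fun g hg => ?_⟩
  rw [lintegral_map hg hm, lintegral_bergmanMeasure α hg,
    lintegral_bergmanMeasure α (g := fun z => g ((u : ℂ) * z)) (by fun_prop),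
    ← (measurePreserving_circle_mul u).lintegral_comp (f := fun z =>
      ENNReal.ofReal ((α + 1) * (1 - ‖z‖ ^ 2) ^ (α + 2)) * g z) (by fun_prop)]
  simp_rw [norm_mul, Circle.norm_coe, one_mul]

theorem integral_circle_mul_bergmanMeasure {E : Type*} [NormedAddCommGroup E] [NormedSpace ℝ E]
    (α : ℝ) (u : Circle) {Φ : ℂ → E} (hΦ : AEStronglyMeasurable Φ (bergmanMeasure α)) :
    ∫ ζ, Φ (u * ζ) ∂(bergmanMeasure α) = ∫ ζ, Φ ζ ∂(bergmanMeasure α) := by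
  have h := measurePreserving_circle_mul_bergmanMeasure α u
  conv_rhs => rw [← h.map_eq]
  rw [integral_map h.measurable.aemeasurable (by rwa [h.map_eq])]

theorem memLp_two_of_lintegral_normSq {α : ℝ} {F : ℂ → ℂ} (hFm : Measurable F)
    (hfin : ∫⁻ ζ, ‖F ζ‖ₑ ^ 2 ∂(bergmanMeasure α) ≠ ∞) : MemLp F 2 (bergmanMeasure α) := by
  refine ⟨hFm.aestronglyMeasurable, ?_⟩
  rw [eLpNorm_lt_top_iff_lintegral_rpow_enorm_lt_top (by norm_num) (by norm_num)]
  simpa using hfin.lt_top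

/-- The inner product of the weighted Bergman space in terms of the coefficients: averaging over
rotations, which preserve the measure, reduces it to Parseval's identity on circles. -/
theorem bergmanInner_eq_tsum {a b : ℕ → ℂ} {F G : ℂ → ℂ} (hF : HasDiscSeries a F)
    (hG : HasDiscSeries b G) (hFm : Measurable F) (hGm : Measurable G) {α : ℝ} (hα : -1 < α)
    (hFfin : ∫⁻ ζ, ‖F ζ‖ₑ ^ 2 ∂(bergmanMeasure α) ≠ ∞)
    (hGfin : ∫⁻ ζ, ‖G ζ‖ₑ ^ 2 ∂(bergmanMeasure α) ≠ ∞) :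
    bergmanInner α F G = ∑' n, a n * conj (b n) * ((coeffWeight α n)⁻¹ : ℝ) := by
  have hGc : Measurable fun ζ => conj (G ζ) := Complex.continuous_conj.measurable.comp hGm
  have hint : Integrable (fun ζ => F ζ * conj (G ζ)) (bergmanMeasure α) := by
    have h1 := memLp_two_of_lintegral_normSq hFm hFfin
    have h2 : MemLp (fun ζ => conj (G ζ)) 2 (bergmanMeasure α) := by
      refine memLp_two_of_lintegral_normSq hGc ?_
      simpa only [RCLike.enorm_conj] using hGfin
    exact h1.integrable_mul h2
  have hrot (u : Circle) : ∫ ζ, F (u * ζ) * conj (G (u * ζ)) ∂(bergmanMeasure α)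
      = bergmanInner α F G :=
    integral_circle_mul_bergmanMeasure α u hint.aestronglyMeasurable
  have hcoe : Measurable fun q : Circle × ℂ => (q.1 : ℂ) * q.2 :=
    (measurable_circle_coe.comp measurable_fst).mul measurable_snd
  have hprod : Integrable (fun q : Circle × ℂ => F (q.1 * q.2) * conj (G (q.1 * q.2)))
      (circleMeasure.prod (bergmanMeasure α)) := by
    have hm : Measurable fun q : Circle × ℂ => F (q.1 * q.2) * conj (G (q.1 * q.2)) :=
      (hFm.comp hcoe).mul (hGc.comp hcoe)
    rw [integrable_prod_iff hm.aestronglyMeasurable]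
    constructor
    · refine ae_of_all _ fun u => ?_
      exact (measurePreserving_circle_mul_bergmanMeasure α u).integrable_comp_of_integrable
        (g := fun ζ => F ζ * conj (G ζ)) hint
    · have h (u : Circle) : ∫ ζ, ‖F (u * ζ) * conj (G (u * ζ))‖ ∂(bergmanMeasure α)
          = ∫ ζ, ‖F ζ * conj (G ζ)‖ ∂(bergmanMeasure α) :=
        integral_circle_mul_bergmanMeasure α u hint.norm.aestronglyMeasurable
      simp only [h]
      exact integrable_const _
  calc bergmanInner α F G
      = ∫ u : Circle, ∫ ζ, F (u * ζ) * conj (G (u * ζ)) ∂(bergmanMeasure α) ∂circleMeasure := by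
        simp_rw [hrot]
        simp
    _ = ∫ ζ, ∫ u : Circle, F (u * ζ) * conj (G (u * ζ)) ∂circleMeasure ∂(bergmanMeasure α) :=
        integral_integral_swap hprod
    _ = ∫ ζ, ∑' n, (a n * conj (b n)) * ((‖ζ‖ ^ (2 * n) : ℝ) : ℂ) ∂(bergmanMeasure α) := by
        refine integral_congr_ae ?_
        filter_upwards [ae_bergmanMeasure_mem_disc α] with ζ hζ
        simp_rw [hF.apply_circle_mul hζ, hG.apply_circle_mul hζ]
        rw [integral_circle_series (hF.summable_norm hζ) (hG.summable_norm hζ)]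
        congr 1
        ext n
        rw [map_mul, map_pow, pow_mul]
        push_cast
        rw [← Complex.mul_conj', mul_pow]
        ring
    _ = ∑' n, ∫ ζ, (a n * conj (b n)) * ((‖ζ‖ ^ (2 * n) : ℝ) : ℂ) ∂(bergmanMeasure α) := by
        rw [integral_tsum_of_summable_integral_norm]
        · exact fun n => ((integrable_norm_pow_bergmanMeasure hα n).ofReal).const_mul _
        · have h (n : ℕ) : ∫ ζ, ‖(a n * conj (b n)) * ((‖ζ‖ ^ (2 * n) : ℝ) : ℂ)‖ ∂(bergmanMeasure α)
              = ‖a n‖ * ‖b n‖ * (coeffWeight α n)⁻¹ := by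
            rw [← integral_norm_pow_bergmanMeasure hα n, ← integral_const_mul]
            congr 1
            ext ζ
            rw [norm_mul, norm_mul, RCLike.norm_conj, Complex.norm_real, Real.norm_of_nonneg
              (by positivity)]
          simp_rw [h]
          refine Summable.of_nonneg_of_le (fun n => ?_) (fun n => ?_)
            ((hF.summable_normSq hFm hα hFfin).add (hG.summable_normSq hGm hα hGfin))
          · have := coeffWeight_pos hα n; positivity
          · have := inv_pos.2 (coeffWeight_pos hα n)
            rw [← add_mul]
            refine mul_le_mul_of_nonneg_right ?_ this.le
            nlinarith [sq_nonneg (‖a n‖ - ‖b n‖), sq_nonneg (‖a n‖), sq_nonneg ‖b n‖]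
    _ = _ := by
        congr 1
        ext n
        rw [integral_const_mul, integral_complex_ofReal, integral_norm_pow_bergmanMeasure hα]

/-- The inner product with a monomial reads off a Taylor coefficient. -/
theorem bergmanInner_pow {a : ℕ → ℂ} {F : ℂ → ℂ} (hF : HasDiscSeries a F)
    (hFm : Measurable F) {α : ℝ} (hα : -1 < α)
    (hFfin : ∫⁻ ζ, ‖F ζ‖ₑ ^ 2 ∂(bergmanMeasure α) ≠ ∞) (n : ℕ) :
    bergmanInner α F (fun ζ => ζ ^ n) = a n * ((coeffWeight α n)⁻¹ : ℝ) := by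
  rw [bergmanInner_eq_tsum hF (hasDiscSeries_pow n) hFm (by fun_prop) hα hFfin, tsum_eq_single n]
  · simp
  · intro m hm
    simp [hm]
  · have h := lintegral_norm_pow_bergmanMeasure hα n
    simp_rw [enorm_pow, ← pow_mul, mul_comm n, h]
    exact ENNReal.ofReal_ne_top

/-- The Cauchy-Schwarz inequality. -/
theorem enorm_bergmanInner_sq_le {F G : ℂ → ℂ} (hFm : Measurable F) (hGm : Measurable G) (α : ℝ) :
    ‖bergmanInner α F G‖ₑ ^ 2 ≤ (∫⁻ ζ, ‖F ζ‖ₑ ^ 2 ∂(bergmanMeasure α)) *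
      ∫⁻ ζ, ‖G ζ‖ₑ ^ 2 ∂(bergmanMeasure α) := by
  have h1 : ‖bergmanInner α F G‖ₑ ≤ ∫⁻ ζ, ‖F ζ‖ₑ * ‖G ζ‖ₑ ∂(bergmanMeasure α) := by
    refine (enorm_integral_le_lintegral_enorm _).trans_eq ?_
    simp_rw [enorm_mul, RCLike.enorm_conj]
  have h2 := ENNReal.lintegral_mul_le_Lp_mul_Lq (bergmanMeasure α) Real.HolderConjugate.two_two
    (f := fun ζ => ‖F ζ‖ₑ) (g := fun ζ => ‖G ζ‖ₑ) (by fun_prop) (by fun_prop)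
  have h3 := h1.trans h2
  refine (pow_le_pow_left' h3 2).trans_eq ?_
  rw [mul_pow, ← ENNReal.rpow_natCast, ← ENNReal.rpow_natCast, ← ENNReal.rpow_mul,
    ← ENNReal.rpow_mul]
  simp

/-! ### Matrix coefficients of the Möbius shifts -/

/-- A real power series that vanishes on `(0, 1)` is zero. -/
theorem eq_zero_of_hasSum_pow_zero {c : ℕ → ℝ}
    (hc : ∀ x : ℝ, 0 < x → x < 1 → HasSum (fun n => c n * x ^ n) 0) : c = 0 := by
  have hr : 1 ≤ (FormalMultilinearSeries.ofScalars ℝ c).radius := by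
    refine ENNReal.le_of_forall_nnreal_lt fun r hr => ?_
    refine FormalMultilinearSeries.le_radius_of_summable_norm _ ?_
    have hr1 : (r : ℝ) < 1 := by exact_mod_cast hr
    rcases eq_or_lt_of_le r.coe_nonneg with h0 | h0
    · rw [← h0]
      refine summable_of_ne_finset_zero (s := {0}) fun n hn => ?_
      rw [Finset.mem_singleton] at hn
      simp [hn]
    · refine (hc r h0 hr1).summable.norm.congr fun n => ?_
      simp
  have hp :=
    (FormalMultilinearSeries.hasFPowerSeriesOnBall _ (one_pos.trans_le hr)).hasFPowerSeriesAt
  by_contra hne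
  have hpne : FormalMultilinearSeries.ofScalars ℝ c ≠ 0 := by
    intro h
    apply hne
    ext n
    have h1 := FormalMultilinearSeries.ofScalars_norm ℝ c n
    rw [h] at h1
    simpa using h1.symm
  have h1 := hp.locally_ne_zero hpne
  have h2 : ∀ᶠ x : ℝ in 𝓝[>] 0, x ∈ Set.Ioo (0 : ℝ) 1 := Ioo_mem_nhdsGT one_pos
  have h3 : 𝓝[>] (0 : ℝ) ≤ 𝓝[≠] 0 := nhdsWithin_mono _ fun x hx => ne_of_gt hx
  obtain ⟨x, hx, hx0, hx1⟩ := ((h1.filter_mono h3).and h2).exists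
  apply hx
  rw [FormalMultilinearSeries.sum, ← (hc x hx0 hx1).tsum_eq]
  congr 1
  ext n
  rw [FormalMultilinearSeries.ofScalars_apply_eq, smul_eq_mul]

/-- The squared modulus of the matrix coefficient `⟨h, U_w e_n⟩`, where `e_n` is the normalized
monomial of degree `n`. It is written as the squared modulus of `⟨U_{-w} h, e_n⟩`. -/
def coeffMass (α : ℝ) (h : ℂ → ℂ) (n : ℕ) (w : ℂ) : ℝ≥0∞ :=
  ENNReal.ofReal (coeffWeight α n) *
    ‖bergmanInner α (moebiusShift α (-w) h) (fun ζ => ζ ^ n)‖ₑ ^ 2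

theorem measurable_coeffMass (α : ℝ) {h : ℂ → ℂ} (hh : Measurable h) (n : ℕ) :
    Measurable (coeffMass α h n) := by
  have h1 : Measurable fun q : ℂ × ℂ => moebiusShift α (-q.1) h q.2 * conj (q.2 ^ n) := by
    refine Measurable.mul ?_ (Complex.continuous_conj.measurable.comp (by fun_prop))
    exact (measurable_moebiusShift_uncurry α hh).comp (measurable_fst.neg.prodMk measurable_snd)
  have h2 : Measurable fun w => bergmanInner α (moebiusShift α (-w) h) (fun ζ => ζ ^ n) :=
    (h1.stronglyMeasurable.integral_prod_right' (ν := bergmanMeasure α)).measurable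
  unfold coeffMass
  fun_prop

section

variable {α : ℝ} {h : ℂ → ℂ}

theorem lintegral_normSq_moebiusShift_univ (hα : -1 < α) (hh : Measurable h) {z : ℂ}
    (hz : z ∈ disc) :
    ∫⁻ ζ, ‖moebiusShift α z h ζ‖ₑ ^ 2 ∂(bergmanMeasure α)
      = ∫⁻ ζ, ‖h ζ‖ₑ ^ 2 ∂(bergmanMeasure α) := by
  simpa using lintegral_normSq_moebiusShift hα hz hh (g := fun _ => 1) measurable_const

theorem coeffMass_eq (hα : -1 < α) (hh : Measurable h) (hd : DifferentiableOn ℂ h disc)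
    (hfin : ∫⁻ ζ, ‖h ζ‖ₑ ^ 2 ∂(bergmanMeasure α) ≠ ∞) {w : ℂ} (hw : w ∈ disc) (n : ℕ) :
    coeffMass α h n w = ‖taylorCoeff (moebiusShift α (-w) h) n‖ₑ ^ 2 *
      ENNReal.ofReal (coeffWeight α n)⁻¹ := by
  have hw' := neg_mem_disc hw
  have hγ := coeffWeight_pos hα n
  have hs := hasDiscSeries_taylorCoeff (differentiableOn_moebiusShift α hw' hd)
  have hfin' : ∫⁻ ζ, ‖moebiusShift α (-w) h ζ‖ₑ ^ 2 ∂(bergmanMeasure α) ≠ ∞ := by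
    rwa [lintegral_normSq_moebiusShift_univ hα hh hw']
  rw [coeffMass, bergmanInner_pow hs (measurable_moebiusShift α _ hh) hα hfin', enorm_mul, mul_pow,
    ← ofReal_norm (((coeffWeight α n)⁻¹ : ℝ) : ℂ), Complex.norm_real,
    Real.norm_of_nonneg (inv_nonneg.2 hγ.le), ← ENNReal.ofReal_pow (inv_nonneg.2 hγ.le),
    mul_left_comm, ← ENNReal.ofReal_mul hγ.le]
  congr 2
  field_simp

/-- Parseval's identity for `U_{-w} h` on the circle of radius `r`: the circular averages of the
invariant density form the generating function of the matrix coefficient masses. -/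
theorem lintegral_circle_invariantDensity (hα : -1 < α) (hh : Measurable h)
    (hd : DifferentiableOn ℂ h disc) (hfin : ∫⁻ ζ, ‖h ζ‖ₑ ^ 2 ∂(bergmanMeasure α) ≠ ∞)
    {w : ℂ} (hw : w ∈ disc) {r : ℝ} (hr0 : 0 ≤ r) (hr1 : r < 1) :
    ∫⁻ u : Circle, invariantDensity α h (moebius (-w) (u * (r : ℂ))) ∂circleMeasure
      = ENNReal.ofReal ((1 - r ^ 2) ^ (α + 2)) *
        ∑' n, ENNReal.ofReal (coeffWeight α n * (r ^ 2) ^ n) * coeffMass α h n w := by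
  have hw' := neg_mem_disc hw
  have hr : (r : ℂ) ∈ disc := by
    rw [mem_disc, Complex.norm_real, Real.norm_of_nonneg hr0]; exact hr1
  have hs := hasDiscSeries_taylorCoeff (differentiableOn_moebiusShift α hw' hd)
  have hm : Measurable fun u : Circle => ‖moebiusShift α (-w) h (u * (r : ℂ))‖ₑ ^ 2 := by
    have h1 := measurable_circle_coe
    have h2 := measurable_moebiusShift α (-w) hh
    fun_prop
  have hden (u : Circle) : invariantDensity α h (moebius (-w) (u * (r : ℂ)))
      = ENNReal.ofReal ((1 - r ^ 2) ^ (α + 2)) *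
        ‖moebiusShift α (-w) h (u * (r : ℂ))‖ₑ ^ 2 := by
    rw [← invariantDensity_moebiusShift α h hw' ((circle_mul_mem_disc u).2 hr), invariantDensity,
      norm_mul, Circle.norm_coe, one_mul, Complex.norm_real, Real.norm_of_nonneg hr0]
  simp_rw [hden]
  rw [lintegral_const_mul _ hm, hs.lintegral_circle hr]
  congr 2
  ext n
  have hγ := coeffWeight_pos hα n
  rw [coeffMass_eq hα hh hd hfin hw, ← ofReal_norm (r : ℂ), Complex.norm_real,
    Real.norm_of_nonneg hr0, ← ENNReal.ofReal_pow hr0, mul_left_comm,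
    ← ENNReal.ofReal_mul (by positivity)]
  congr 2
  rw [pow_mul]
  field_simp

/-- The generating function of the matrix coefficient masses over a set `E`. -/
theorem setLIntegral_circle_invariantDensity (hα : -1 < α) (hh : Measurable h)
    (hd : DifferentiableOn ℂ h disc) (hfin : ∫⁻ ζ, ‖h ζ‖ₑ ^ 2 ∂(bergmanMeasure α) ≠ ∞)
    {r : ℝ} (hr0 : 0 ≤ r) (hr1 : r < 1) (E : Set ℂ) :
    ENNReal.ofReal (α + 1) * ∫⁻ w in E, ∫⁻ u : Circle,
        invariantDensity α h (moebius (-w) (u * (r : ℂ))) ∂circleMeasure ∂moebiusMeasure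
      = ENNReal.ofReal ((1 - r ^ 2) ^ (α + 2)) *
        ∑' n, ENNReal.ofReal (coeffWeight α n * (r ^ 2) ^ n) *
          (ENNReal.ofReal (α + 1) * ∫⁻ w in E, coeffMass α h n w ∂moebiusMeasure) := by
  have h1 : ∫⁻ w in E, ∫⁻ u : Circle,
        invariantDensity α h (moebius (-w) (u * (r : ℂ))) ∂circleMeasure ∂moebiusMeasure
      = ∫⁻ w in E, ENNReal.ofReal ((1 - r ^ 2) ^ (α + 2)) *
        ∑' n, ENNReal.ofReal (coeffWeight α n * (r ^ 2) ^ n) * coeffMass α h n w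
          ∂moebiusMeasure := by
    refine lintegral_congr_ae ?_
    filter_upwards [ae_restrict_of_ae ae_mem_disc] with w hw
    exact lintegral_circle_invariantDensity hα hh hd hfin hw hr0 hr1
  have hm := measurable_coeffMass α hh
  rw [h1, lintegral_const_mul' _ _ ENNReal.ofReal_ne_top, lintegral_tsum (by fun_prop),
    mul_left_comm, ← ENNReal.tsum_mul_left]
  congr 2
  ext n
  rw [lintegral_const_mul _ (hm n)]
  ring

/-- Schur orthogonality: every normalized monomial has the same total matrix coefficient mass
against `h`. The generating function of these masses is the binomial series, because averaging
over rotations turns the left side into the norm of `h`. -/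
theorem lintegral_coeffMass (hα : -1 < α) (hh : Measurable h)
    (hd : DifferentiableOn ℂ h disc) (hfin : ∫⁻ ζ, ‖h ζ‖ₑ ^ 2 ∂(bergmanMeasure α) ≠ ∞) (n : ℕ) :
    ENNReal.ofReal (α + 1) * ∫⁻ w, coeffMass α h n w ∂moebiusMeasure
      = ∫⁻ ζ, ‖h ζ‖ₑ ^ 2 ∂(bergmanMeasure α) := by
  set N := ∫⁻ ζ, ‖h ζ‖ₑ ^ 2 ∂(bergmanMeasure α) with hN
  set M : ℕ → ℝ≥0∞ := fun n => ENNReal.ofReal (α + 1) * ∫⁻ w, coeffMass α h n w ∂moebiusMeasure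
    with hM
  have hγ := coeffWeight_pos hα
  -- the generating function identity, at `x = r²`
  have key (x : ℝ) (hx0 : 0 < x) (hx1 : x < 1) :
      ENNReal.ofReal ((1 - x) ^ (α + 2)) * ∑' n, ENNReal.ofReal (coeffWeight α n * x ^ n) * M n
        = N := by
    have hs0 := Real.sqrt_nonneg x
    have hs1 : √x < 1 := by rw [Real.sqrt_lt' one_pos]; simpa using hx1
    have h1 := setLIntegral_circle_invariantDensity hα hh hd hfin hs0 hs1 Set.univ
    have hr : ((√x : ℝ) : ℂ) ∈ disc := by
      rw [mem_disc, Complex.norm_real, Real.norm_of_nonneg hs0]; exact hs1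
    simp only [Measure.restrict_univ, Real.sq_sqrt hx0.le] at h1
    rw [← h1, lintegral_moebius_neg_average hr (measurable_invariantDensity α hh)]
    have h2 := lintegral_mul_normSq_bergmanMeasure hα (g := fun _ => 1) measurable_const hh
    simpa using h2.symm
  change M n = N
  clear_value M
  have hMfin (n : ℕ) : M n ≠ ∞ := by
    intro htop
    have h1 := key (1 / 2) (by norm_num) (by norm_num)
    have h2 : ∑' n, ENNReal.ofReal (coeffWeight α n * (1 / 2) ^ n) * M n = ∞ := by
      refine ENNReal.tsum_eq_top_of_eq_top ⟨n, ?_⟩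
      have := hγ n
      rw [htop, ENNReal.mul_top]
      simp only [ne_eq, ENNReal.ofReal_eq_zero, not_le]
      positivity
    rw [h2, ENNReal.mul_top] at h1
    · exact hfin h1.symm
    · simp only [ne_eq, ENNReal.ofReal_eq_zero, not_le]
      positivity
  have hsum (x : ℝ) (hx0 : 0 < x) (hx1 : x < 1) :
      HasSum (fun n => coeffWeight α n * x ^ n * (M n).toReal)
        (N.toReal * (1 - x) ^ (-(α + 2))) := by
    have hx : 0 < (1 - x) ^ (α + 2) := Real.rpow_pos_of_pos (by linarith) _
    have h1 := key x hx0 hx1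
    have h2 : ∑' n, ENNReal.ofReal (coeffWeight α n * x ^ n) * M n ≠ ∞ := by
      intro h
      rw [h, ENNReal.mul_top (by simpa using hx)] at h1
      exact hfin h1.symm
    have h3 := ENNReal.hasSum_toReal h2
    have h4 := congrArg ENNReal.toReal h1
    rw [ENNReal.toReal_mul, ENNReal.toReal_ofReal hx.le] at h4
    convert! h3 using 1
    · ext n
      rw [ENNReal.toReal_mul, ENNReal.toReal_ofReal]
      have := hγ n
      positivity
    · rw [← h4, Real.rpow_neg (by linarith)]
      field_simp
      rw [ENNReal.tsum_toReal_eq]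
      intro n
      exact ENNReal.mul_ne_top ENNReal.ofReal_ne_top (hMfin n)
  have hzero : (fun n => coeffWeight α n * ((M n).toReal - N.toReal)) = 0 := by
    refine eq_zero_of_hasSum_pow_zero fun x hx0 hx1 => ?_
    have h1 := hsum x hx0 hx1
    have h2 := (hasSum_coeffWeight hα (x := x)
      (by rw [abs_of_pos hx0]; exact hx1)).mul_left N.toReal
    have h3 := h1.sub h2
    rw [sub_self] at h3
    convert! h3 using 2 with k
    ring
  have h := congrFun hzero n
  simp only [Pi.zero_apply, mul_eq_zero, (hγ n).ne', false_or, sub_eq_zero] at h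
  exact (ENNReal.toReal_eq_toReal_iff' (hMfin n) hfin).1 h

/-- If `φ_{-w}` maps the circle of radius `r` into `E'` for every `w ∈ E`, the matrix coefficient
mass over `E` is controlled by the mass of `h` over `E'`. -/
theorem setLIntegral_coeffMass_le (hα : -1 < α) (hh : Measurable h)
    (hd : DifferentiableOn ℂ h disc) (hfin : ∫⁻ ζ, ‖h ζ‖ₑ ^ 2 ∂(bergmanMeasure α) ≠ ∞)
    {r : ℝ} (hr0 : 0 ≤ r) (hr1 : r < 1) {E E' : Set ℂ} (hE : MeasurableSet E)
    (hE' : MeasurableSet E')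
    (hEE' : ∀ w ∈ E, w ∈ disc → ∀ u : Circle, moebius (-w) (u * (r : ℂ)) ∈ E') (n : ℕ) :
    ENNReal.ofReal ((1 - r ^ 2) ^ (α + 2) * (coeffWeight α n * (r ^ 2) ^ n)) *
      (ENNReal.ofReal (α + 1) * ∫⁻ w in E, coeffMass α h n w ∂moebiusMeasure)
      ≤ ∫⁻ ζ in E', ‖h ζ‖ₑ ^ 2 ∂(bergmanMeasure α) := by
  have hr : (r : ℂ) ∈ disc := by
    rw [mem_disc, Complex.norm_real, Real.norm_of_nonneg hr0]; exact hr1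
  have hI := measurable_invariantDensity α hh
  calc _ = ENNReal.ofReal ((1 - r ^ 2) ^ (α + 2)) *
        (ENNReal.ofReal (coeffWeight α n * (r ^ 2) ^ n) *
          (ENNReal.ofReal (α + 1) * ∫⁻ w in E, coeffMass α h n w ∂moebiusMeasure)) := by
        rw [ENNReal.ofReal_mul (Real.rpow_nonneg (by nlinarith) _)]
        ring
    _ ≤ ENNReal.ofReal (α + 1) * ∫⁻ w in E, ∫⁻ u : Circle,
        invariantDensity α h (moebius (-w) (u * (r : ℂ))) ∂circleMeasure ∂moebiusMeasure := by
        rw [setLIntegral_circle_invariantDensity hα hh hd hfin hr0 hr1]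
        gcongr
        exact ENNReal.le_tsum n
    _ ≤ ENNReal.ofReal (α + 1) * ∫⁻ w, ∫⁻ u : Circle,
        (E'.indicator (invariantDensity α h)) (moebius (-w) (u * (r : ℂ))) ∂circleMeasure
          ∂moebiusMeasure := by
        refine mul_le_mul' le_rfl ?_
        rw [← lintegral_indicator hE]
        refine lintegral_mono_ae ?_
        filter_upwards [ae_mem_disc] with w hw
        by_cases hwE : w ∈ E
        · rw [Set.indicator_of_mem hwE]
          refine lintegral_mono fun u => ?_
          rw [Set.indicator_of_mem (hEE' w hwE hw u)]
        · rw [Set.indicator_of_notMem hwE]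
          exact zero_le
    _ = ENNReal.ofReal (α + 1) * ∫⁻ w, E'.indicator 1 w * invariantDensity α h w
          ∂moebiusMeasure := by
        rw [lintegral_moebius_neg_average hr (hI.indicator hE')]
        congr 2
        ext w
        by_cases hw : w ∈ E' <;> simp [hw]
    _ = ∫⁻ ζ in E', ‖h ζ‖ₑ ^ 2 ∂(bergmanMeasure α) := by
        rw [← lintegral_mul_normSq_bergmanMeasure hα (measurable_one.indicator hE') hh,
          ← lintegral_indicator hE']
        congr 1
        ext w
        by_cases hw : w ∈ E' <;> simp [hw]

/-- Averaging over the rotations of the window `g = ∑ b_n ζ^n` removes the interference between its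
monomials and leaves a mixture of the matrix coefficient masses. -/
theorem lintegral_circle_bergmanInner_moebiusShift (hα : -1 < α) (hh : Measurable h)
    (hd : DifferentiableOn ℂ h disc) (hfin : ∫⁻ ζ, ‖h ζ‖ₑ ^ 2 ∂(bergmanMeasure α) ≠ ∞)
    {g : ℂ → ℂ} {b : ℕ → ℂ} (hg : Measurable g) (hb : HasDiscSeries b g)
    (hgfin : ∫⁻ ζ, ‖g ζ‖ₑ ^ 2 ∂(bergmanMeasure α) ≠ ∞) {w : ℂ} (hw : w ∈ disc) :
    ∫⁻ u : Circle, ‖bergmanInner α h (moebiusShift α w (rotate u g))‖ₑ ^ 2 ∂circleMeasure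
      = ∑' n, ‖b n‖ₑ ^ 2 * ENNReal.ofReal (coeffWeight α n)⁻¹ * coeffMass α h n w := by
  have hw' := neg_mem_disc hw
  set F := moebiusShift α (-w) h with hF
  have hFm : Measurable F := measurable_moebiusShift α (-w) hh
  have hs : HasDiscSeries (taylorCoeff F) F :=
    hasDiscSeries_taylorCoeff (differentiableOn_moebiusShift α hw' hd)
  have hFfin : ∫⁻ ζ, ‖F ζ‖ₑ ^ 2 ∂(bergmanMeasure α) ≠ ∞ := by
    rwa [hF, lintegral_normSq_moebiusShift_univ hα hh hw']
  have hgfin' (u : Circle) : ∫⁻ ζ, ‖rotate u g ζ‖ₑ ^ 2 ∂(bergmanMeasure α) ≠ ∞ := by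
    have := lintegral_normSq_rotate α u hg (g := fun _ => 1) measurable_const
    simp only [one_mul] at this
    unfold rotate
    rwa [this]
  set c : ℕ → ℂ := fun n => conj (taylorCoeff F n) * b n * ((coeffWeight α n)⁻¹ : ℝ) with hc
  have hinner (u : Circle) : ‖bergmanInner α h (moebiusShift α w (rotate u g))‖ₑ
      = ‖∑' n, c n * (u : ℂ) ^ n‖ₑ := by
    rw [bergmanInner_moebiusShift_right hα hw hh (measurable_rotate u hg),
      bergmanInner_eq_tsum hs (hb.rotate u) hFm (measurable_rotate u hg) hα hFfin (hgfin' u),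
      ← RCLike.enorm_conj, Complex.conj_tsum]
    congr 2
    ext n
    simp only [hc, map_mul, Complex.conj_conj, Complex.conj_ofReal]
    ring
  have hsum : Summable fun n => ‖c n‖ := by
    refine Summable.of_nonneg_of_le (fun n => norm_nonneg _) (fun n => ?_)
      ((hs.summable_normSq hFm hα hFfin).add (hb.summable_normSq hg hα hgfin))
    have := inv_pos.2 (coeffWeight_pos hα n)
    rw [← add_mul, hc]
    simp only [norm_mul, RCLike.norm_conj, Complex.norm_real, Real.norm_of_nonneg this.le]
    refine mul_le_mul_of_nonneg_right ?_ this.le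
    nlinarith [sq_nonneg (‖taylorCoeff F n‖ - ‖b n‖), sq_nonneg ‖taylorCoeff F n‖,
      sq_nonneg ‖b n‖]
  simp_rw [hinner]
  rw [lintegral_circle_series hsum]
  congr 1
  ext n
  have hγ := inv_pos.2 (coeffWeight_pos hα n)
  rw [coeffMass_eq hα hh hd hfin hw, hc]
  simp only [enorm_mul, RCLike.enorm_conj, mul_pow]
  rw [← ofReal_norm (((coeffWeight α n)⁻¹ : ℝ) : ℂ), Complex.norm_real, Real.norm_of_nonneg hγ.le]
  ring

end

/-! ### The windows `V^α ψ` -/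

theorem measurable_indicator_disc {F : ℂ → ℂ} (hF : ContinuousOn F disc) :
    Measurable (disc.indicator F) := by
  classical
  rw [← Set.piecewise_eq_indicator]
  exact hF.measurable_piecewise continuousOn_const measurableSet_disc

/-- The coefficients of `ψ` with respect to the orthonormal basis `√(n + 1) z ^ n` of `A²`. The
operator `V^α` keeps these coefficients and replaces the basis by that of `A²_α`. -/
def normalizedCoeff (ψ : ℂ → ℂ) (n : ℕ) : ℂ := taylorCoeff ψ n / (Real.sqrt ((n : ℝ) + 1) : ℂ)

/-- The case `α = 0` of the norm formula, in which `γ_n = n + 1`. -/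
theorem tsum_normalizedCoeff {ψ : ℂ → ℂ} (hψ : MemBergman 0 ψ) (hψ1 : bergmanNorm 0 ψ = 1) :
    ∑' n, ‖normalizedCoeff ψ n‖ₑ ^ 2 = 1 := by
  have hm := measurable_indicator_disc hψ.holomorphic.continuousOn
  have hs : HasDiscSeries (taylorCoeff ψ) (disc.indicator ψ) :=
    (hasDiscSeries_taylorCoeff hψ.holomorphic).congr fun z hz => Set.indicator_of_mem hz _
  have h1 := hs.lintegral_normSq hm (α := 0) (by norm_num)
  have h2 : ∫ ζ, ‖ψ ζ‖ ^ 2 ∂(bergmanMeasure 0) = 1 := by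
    rw [bergmanNorm, Real.sqrt_eq_one] at hψ1
    exact hψ1
  have h3 : ∫⁻ ζ, ‖disc.indicator ψ ζ‖ₑ ^ 2 ∂(bergmanMeasure 0) = 1 := by
    rw [← ENNReal.ofReal_one, ← h2, ofReal_integral_eq_lintegral_ofReal
      (by simpa using hψ.memLp.integrable_norm_pow two_ne_zero)
      (ae_of_all _ fun _ => by positivity)]
    refine lintegral_congr_ae ?_
    filter_upwards [ae_bergmanMeasure_mem_disc 0] with ζ hζ
    rw [Set.indicator_of_mem hζ, ENNReal.ofReal_pow (norm_nonneg _), ofReal_norm]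
  rw [← h3, h1]
  congr 1
  ext n
  have hn : (0 : ℝ) < (n : ℝ) + 1 := by positivity
  rw [normalizedCoeff, coeffWeight_zero_left, div_eq_mul_inv, enorm_mul, mul_pow]
  congr 1
  rw [← Complex.ofReal_inv, ← ofReal_norm, Complex.norm_real, Real.norm_of_nonneg (by positivity),
    ← ENNReal.ofReal_pow (by positivity), inv_pow, Real.sq_sqrt hn.le]

/-- The Taylor coefficients of `V^α ψ`. -/
def windowCoeff (α : ℝ) (ψ : ℂ → ℂ) (n : ℕ) : ℂ :=
  normalizedCoeff ψ n * (Real.sqrt (coeffWeight α n) : ℂ)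

theorem enorm_windowCoeff_sq {α : ℝ} (hα : -1 < α) (ψ : ℂ → ℂ) (n : ℕ) :
    ‖windowCoeff α ψ n‖ₑ ^ 2 * ENNReal.ofReal (coeffWeight α n)⁻¹ = ‖normalizedCoeff ψ n‖ₑ ^ 2 := by
  have hγ := coeffWeight_pos hα n
  rw [windowCoeff, enorm_mul, mul_pow, ← ofReal_norm ((√(coeffWeight α n) : ℝ) : ℂ),
    Complex.norm_real, Real.norm_of_nonneg (by positivity), ← ENNReal.ofReal_pow (by positivity),
    Real.sq_sqrt hγ.le, mul_assoc, ← ENNReal.ofReal_mul hγ.le, mul_inv_cancel₀ hγ.ne',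
    ENNReal.ofReal_one, mul_one]

/-- The series that defines `V^α ψ` converges on the disc, so that `fracDiff` takes no junk value
there. -/
theorem hasDiscSeries_fracDiff {ψ : ℂ → ℂ} (hψ : ∑' n, ‖normalizedCoeff ψ n‖ₑ ^ 2 = 1) {α : ℝ}
    (hα : -1 < α) : HasDiscSeries (windowCoeff α ψ) (fracDiff α ψ) := by
  intro z hz
  have h1 (n : ℕ) : ‖normalizedCoeff ψ n‖ ≤ 1 := by
    have h := (ENNReal.le_tsum n).trans_eq hψ
    rw [pow_le_one_iff two_ne_zero, ← ofReal_norm, ENNReal.ofReal_le_one] at h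
    exact h
  have hz' : ‖z‖ < 1 := mem_disc.1 hz
  have hs1 := (hasSum_coeffWeight hα (x := ‖z‖) (by rwa [abs_of_nonneg (norm_nonneg _)])).summable
  have hs2 := summable_geometric_of_lt_one (norm_nonneg z) hz'
  have hs : Summable fun n => windowCoeff α ψ n * z ^ n := by
    refine Summable.of_norm_bounded (hs1.add hs2) fun n => ?_
    have hγ := coeffWeight_pos hα n
    have h2 : √(coeffWeight α n) ≤ coeffWeight α n + 1 := by
      rw [Real.sqrt_le_left (by positivity)]
      nlinarith
    rw [windowCoeff, norm_mul, norm_mul, norm_pow, Complex.norm_real,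
      Real.norm_of_nonneg (by positivity), ← add_one_mul]
    refine mul_le_mul_of_nonneg_right ?_ (by positivity)
    calc ‖normalizedCoeff ψ n‖ * √(coeffWeight α n) ≤ 1 * √(coeffWeight α n) := by
          gcongr; exact h1 n
      _ ≤ _ := by rwa [one_mul]
  exact hs.hasSum

/-! ### The normalized kernel -/

/-- The kernel of the windowed Berezin transform, including its normalizing factor `α + 1`. -/
def berezinDensity (α : ℝ) (g : ℂ → ℂ) (a b : Circle × ℂ) : ℝ≥0∞ :=
  ENNReal.ofReal (α + 1) *
    ‖bergmanInner α (moebiusShift α a.2 (rotate a.1 g)) (moebiusShift α b.2 (rotate b.1 g))‖ₑ ^ 2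

theorem ofReal_berezinKernel {α : ℝ} (hα : -1 < α) (g : ℂ → ℂ) (a b : Circle × ℂ) :
    ENNReal.ofReal ((α + 1) * berezinKernel α g a b) = berezinDensity α g a b := by
  rw [ENNReal.ofReal_mul (by linarith), berezinKernel, ENNReal.ofReal_pow (norm_nonneg _),
    ofReal_norm, berezinDensity]

theorem measurable_bergmanInner_moebiusShift (α : ℝ) {g : ℂ → ℂ} (hg : Measurable g) :
    Measurable fun q : (Circle × ℂ) × (Circle × ℂ) =>
      bergmanInner α (moebiusShift α q.1.2 (rotate q.1.1 g))
        (moebiusShift α q.2.2 (rotate q.2.1 g)) := by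
  have h := measurable_moebiusShift_rotate_uncurry α hg
  have h1 : Measurable fun q : ((Circle × ℂ) × (Circle × ℂ)) × ℂ =>
      moebiusShift α q.1.1.2 (rotate q.1.1.1 g) q.2 :=
    h.comp (g := fun q : (Circle × ℂ) × ℂ => moebiusShift α q.1.2 (rotate q.1.1 g) q.2)
      (f := fun q : ((Circle × ℂ) × (Circle × ℂ)) × ℂ => (q.1.1, q.2)) (by fun_prop)
  have h2 : Measurable fun q : ((Circle × ℂ) × (Circle × ℂ)) × ℂ =>
      moebiusShift α q.1.2.2 (rotate q.1.2.1 g) q.2 :=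
    h.comp (g := fun q : (Circle × ℂ) × ℂ => moebiusShift α q.1.2 (rotate q.1.1 g) q.2)
      (f := fun q : ((Circle × ℂ) × (Circle × ℂ)) × ℂ => (q.1.2, q.2)) (by fun_prop)
  have h3 := h1.mul (Complex.continuous_conj.measurable.comp h2)
  exact (h3.stronglyMeasurable.integral_prod_right' (ν := bergmanMeasure α)).measurable

theorem measurable_berezinDensity (α : ℝ) {g : ℂ → ℂ} (hg : Measurable g) :
    Measurable fun q : (Circle × ℂ) × (Circle × ℂ) => berezinDensity α g q.1 q.2 := by
  have := measurable_bergmanInner_moebiusShift α hg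
  unfold berezinDensity
  fun_prop

theorem measurable_berezinDensity_right (α : ℝ) {g : ℂ → ℂ} (hg : Measurable g)
    (x : Circle × ℂ) : Measurable (berezinDensity α g x) :=
  (measurable_berezinDensity α hg).of_uncurry_left

theorem measurable_berezinKernel (α : ℝ) {g : ℂ → ℂ} (hg : Measurable g) :
    Measurable fun q : (Circle × ℂ) × (Circle × ℂ) => berezinKernel α g q.1 q.2 := by
  have := measurable_bergmanInner_moebiusShift α hg
  unfold berezinKernel
  fun_prop

theorem berezinDensity_comm (α : ℝ) (g : ℂ → ℂ) (a b : Circle × ℂ) :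
    berezinDensity α g a b = berezinDensity α g b a := by
  rw [berezinDensity, berezinDensity, bergmanInner_conj_symm, RCLike.enorm_conj]

theorem moebiusShift_rotate_congr (α : ℝ) {g g' : ℂ → ℂ} (h : ∀ z ∈ disc, g z = g' z)
    (u : Circle) {z ζ : ℂ} (hz : z ∈ disc) (hζ : ζ ∈ disc) :
    moebiusShift α z (rotate u g) ζ = moebiusShift α z (rotate u g') ζ := by
  rw [moebiusShift, moebiusShift, rotate, rotate,
    h _ ((circle_mul_mem_disc u).2 (moebius_mem_disc hz hζ))]

/-- The kernel depends only on the values of the window in the disc. -/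
theorem berezinKernel_congr (α : ℝ) {g g' : ℂ → ℂ} (h : ∀ z ∈ disc, g z = g' z)
    {a b : Circle × ℂ} (ha : a.2 ∈ disc) (hb : b.2 ∈ disc) :
    berezinKernel α g a b = berezinKernel α g' a b := by
  rw [berezinKernel, berezinKernel, bergmanInner, bergmanInner]
  congr 2
  refine integral_congr_ae ?_
  filter_upwards [ae_bergmanMeasure_mem_disc α] with ζ hζ
  rw [moebiusShift_rotate_congr α h _ ha hζ, moebiusShift_rotate_congr α h _ hb hζ]

instance : SigmaFinite haarMeasureTD := by unfold haarMeasureTD; infer_instance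

theorem ae_snd_mem_disc : ∀ᵐ b ∂haarMeasureTD, b.2 ∈ disc :=
  Measure.quasiMeasurePreserving_snd.ae ae_mem_disc

section

variable {α : ℝ} {g : ℂ → ℂ} {b : ℕ → ℂ}

theorem lintegral_normSq_moebiusShift_rotate (hα : -1 < α) (hg : Measurable g)
    {z : ℂ} (hz : z ∈ disc) (u : Circle) {k : ℂ → ℝ≥0∞} (hk : Measurable k) {l : ℝ → ℝ≥0∞}
    (hl : Measurable l) (hkl : ∀ ζ ∈ disc, k (moebius (-z) ζ) ≤ l ‖ζ‖) :
    ∫⁻ ζ, k ζ * ‖moebiusShift α z (rotate u g) ζ‖ₑ ^ 2 ∂(bergmanMeasure α)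
      ≤ ∫⁻ ζ, l ‖ζ‖ * ‖g ζ‖ₑ ^ 2 ∂(bergmanMeasure α) := by
  rw [lintegral_normSq_moebiusShift hα hz (measurable_rotate u hg) hk,
    ← lintegral_normSq_rotate α u hg hl]
  refine lintegral_mono_ae ?_
  filter_upwards [ae_bergmanMeasure_mem_disc α] with ζ hζ
  exact mul_le_mul' (hkl ζ hζ) le_rfl

theorem lintegral_normSq_moebiusShift_rotate_univ (hα : -1 < α) (hg : Measurable g)
    {z : ℂ} (hz : z ∈ disc) (u : Circle) :
    ∫⁻ ζ, ‖moebiusShift α z (rotate u g) ζ‖ₑ ^ 2 ∂(bergmanMeasure α)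
      = ∫⁻ ζ, ‖g ζ‖ₑ ^ 2 ∂(bergmanMeasure α) := by
  rw [lintegral_normSq_moebiusShift_univ hα (measurable_rotate u hg) hz]
  simpa [rotate] using lintegral_normSq_rotate α u hg (g := fun _ => 1) measurable_const

/-- By the Cauchy-Schwarz inequality and unitarity the kernel is bounded. -/
theorem berezinDensity_le (hα : -1 < α) (hg : Measurable g)
    (hg1 : ∫⁻ ζ, ‖g ζ‖ₑ ^ 2 ∂(bergmanMeasure α) = 1) {x y : Circle × ℂ} (hx : x.2 ∈ disc)
    (hy : y.2 ∈ disc) : berezinDensity α g x y ≤ ENNReal.ofReal (α + 1) := by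
  have h := enorm_bergmanInner_sq_le (measurable_moebiusShift α x.2 (measurable_rotate x.1 hg))
    (measurable_moebiusShift α y.2 (measurable_rotate y.1 hg)) α
  rw [lintegral_normSq_moebiusShift_rotate_univ hα hg hx,
    lintegral_normSq_moebiusShift_rotate_univ hα hg hy, hg1, one_mul] at h
  exact (mul_le_mul' le_rfl h).trans_eq (mul_one _)

/-- The mass that the kernel at `x` puts on the points over `E`, as a mixture of matrix coefficient
masses of `U_z g_θ`, where `x = (e^{iθ}, z)`. -/
theorem setLIntegral_berezinDensity (hα : -1 < α) (hg : Measurable g) (hb : HasDiscSeries b g)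
    (hg1 : ∫⁻ ζ, ‖g ζ‖ₑ ^ 2 ∂(bergmanMeasure α) = 1) {x : Circle × ℂ} (hx : x.2 ∈ disc)
    (E : Set ℂ) :
    ∫⁻ y in Prod.snd ⁻¹' E, berezinDensity α g x y ∂haarMeasureTD
      = ∑' n, ‖b n‖ₑ ^ 2 * ENNReal.ofReal (coeffWeight α n)⁻¹ * (ENNReal.ofReal (α + 1) *
        ∫⁻ w in E, coeffMass α (moebiusShift α x.2 (rotate x.1 g)) n w ∂moebiusMeasure) := by
  set h := moebiusShift α x.2 (rotate x.1 g) with hh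
  have hhm : Measurable h := measurable_moebiusShift α x.2 (measurable_rotate x.1 hg)
  have hhd : DifferentiableOn ℂ h disc :=
    differentiableOn_moebiusShift α hx (hb.rotate x.1).differentiableOn
  have hhfin : ∫⁻ ζ, ‖h ζ‖ₑ ^ 2 ∂(bergmanMeasure α) ≠ ∞ := by
    rw [hh, lintegral_normSq_moebiusShift_rotate_univ hα hg hx, hg1]; exact ENNReal.one_ne_top
  have hm' := measurable_berezinDensity_right α hg x
  have hset : (Prod.snd ⁻¹' E : Set (Circle × ℂ)) = Set.univ ×ˢ E := by ext; simp
  rw [haarMeasureTD, hset, ← Measure.prod_restrict, Measure.restrict_univ,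
    lintegral_prod_symm' _ hm']
  have h1 : ∫⁻ w in E, ∫⁻ u, berezinDensity α g x (u, w) ∂circleMeasure ∂moebiusMeasure
      = ∫⁻ w in E, ENNReal.ofReal (α + 1) * ∑' n, ‖b n‖ₑ ^ 2 *
        ENNReal.ofReal (coeffWeight α n)⁻¹ * coeffMass α h n w ∂moebiusMeasure := by
    refine lintegral_congr_ae ?_
    filter_upwards [ae_restrict_of_ae ae_mem_disc] with w hw
    rw [← lintegral_circle_bergmanInner_moebiusShift hα hhm hhd hhfin hg hb
      (by rw [hg1]; exact ENNReal.one_ne_top) hw, ← lintegral_const_mul' _ _ ENNReal.ofReal_ne_top]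
    simp only [berezinDensity, hh]
  have hcm := measurable_coeffMass α hhm
  rw [h1, lintegral_const_mul' _ _ ENNReal.ofReal_ne_top, lintegral_tsum (by fun_prop),
    ← ENNReal.tsum_mul_left]
  congr 1
  ext n
  rw [lintegral_const_mul _ (hcm n)]
  ring

/-- The kernel has total mass one: by `lintegral_coeffMass` all the terms of the mixture have mass
one, and the weights of the mixture add up to the squared norm of the window. -/
theorem lintegral_berezinDensity (hα : -1 < α) (hg : Measurable g) (hb : HasDiscSeries b g)
    (hg1 : ∫⁻ ζ, ‖g ζ‖ₑ ^ 2 ∂(bergmanMeasure α) = 1) {x : Circle × ℂ} (hx : x.2 ∈ disc) :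
    ∫⁻ y, berezinDensity α g x y ∂haarMeasureTD = 1 := by
  have h := setLIntegral_berezinDensity hα hg hb hg1 hx Set.univ
  have h2 := lintegral_normSq_moebiusShift_rotate_univ hα hg hx x.1
  rw [hg1] at h2
  simp only [Set.preimage_univ, Measure.restrict_univ] at h
  rw [h, ← hg1, hb.lintegral_normSq hg hα]
  congr 1
  ext n
  rw [lintegral_coeffMass hα (measurable_moebiusShift α x.2 (measurable_rotate x.1 hg))
    (differentiableOn_moebiusShift α hx (hb.rotate x.1).differentiableOn)
    (by rw [h2]; exact ENNReal.one_ne_top), h2, mul_one]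

end

/-! ### Concentration of the kernel -/

/-- Dominated convergence for series. -/
theorem tendsto_tsum_mul_zero {c : ℕ → ℝ≥0∞} (hc : ∑' n, c n ≠ ∞) {d : ℝ → ℕ → ℝ≥0∞}
    (hd1 : ∀ᶠ α in atTop, ∀ n, d α n ≤ 1) (hd : ∀ n, Tendsto (fun α => d α n) atTop (𝓝 0)) :
    Tendsto (fun α => ∑' n, c n * d α n) atTop (𝓝 0) := by
  have h := tendsto_lintegral_filter_of_dominated_convergence (μ := Measure.count)
    (l := (atTop : Filter ℝ)) (F := fun α n => c n * d α n) (f := fun _ => 0) c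
    (Eventually.of_forall fun α => by fun_prop)
    (hd1.mono fun α hα => ae_of_all _ fun n => mul_le_of_le_one_right' (hα n))
    (by rwa [lintegral_count])
    (ae_of_all _ fun n => by
      have hcn : c n ≠ ∞ := ne_top_of_le_ne_top hc (ENNReal.le_tsum n)
      simpa using ENNReal.Tendsto.const_mul (hd n) (Or.inr hcn))
  simpa [lintegral_count] using h

/-- The mass outside the disc of radius `ρ` of the normalized monomial of degree `n` is `O(1 / α)`,
by Chebyshev's inequality and the ratio of consecutive moments. -/
theorem setLIntegral_norm_pow_le {α : ℝ} (hα : -1 < α) {ρ : ℝ} (hρ : 0 < ρ) (n : ℕ) :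
    ENNReal.ofReal (coeffWeight α n) *
      ∫⁻ ζ, (Set.Ici ρ).indicator 1 ‖ζ‖ * ‖ζ‖ₑ ^ (2 * n) ∂(bergmanMeasure α)
      ≤ min 1 (ENNReal.ofReal ((ρ ^ 2)⁻¹ * ((n + 1) / (α + 2 + n)))) := by
  have hγ := coeffWeight_pos hα n
  have hn : (0 : ℝ) ≤ n := n.cast_nonneg
  refine le_min ?_ ?_
  · calc _ ≤ ENNReal.ofReal (coeffWeight α n) * ∫⁻ ζ, ‖ζ‖ₑ ^ (2 * n) ∂(bergmanMeasure α) := by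
          refine mul_le_mul' le_rfl (lintegral_mono fun ζ => ?_)
          by_cases h : ‖ζ‖ ∈ Set.Ici ρ <;> simp [h]
      _ = 1 := by
          rw [lintegral_norm_pow_bergmanMeasure hα, ← ENNReal.ofReal_mul hγ.le,
            mul_inv_cancel₀ hγ.ne', ENNReal.ofReal_one]
  · calc _ ≤ ENNReal.ofReal (coeffWeight α n) *
          ∫⁻ ζ, ENNReal.ofReal (ρ ^ 2)⁻¹ * ‖ζ‖ₑ ^ (2 * (n + 1)) ∂(bergmanMeasure α) := by
          refine mul_le_mul' le_rfl (lintegral_mono fun ζ => ?_)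
          by_cases h : ‖ζ‖ ∈ Set.Ici ρ
          · have h' : ρ ≤ ‖ζ‖ := h
            rw [Set.indicator_of_mem h, Pi.one_apply, one_mul, ← ofReal_norm,
              ← ENNReal.ofReal_pow (norm_nonneg _), ← ENNReal.ofReal_pow (norm_nonneg _),
              ← ENNReal.ofReal_mul (by positivity)]
            refine ENNReal.ofReal_le_ofReal ?_
            rw [le_inv_mul_iff₀ (by positivity), mul_add, pow_add, mul_comm]
            gcongr
          · simp [h]
      _ = _ := by
          rw [lintegral_const_mul _ (by fun_prop), lintegral_norm_pow_bergmanMeasure hα,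
            ← ENNReal.ofReal_mul (by positivity), ← ENNReal.ofReal_mul hγ.le, coeffWeight_succ hα]
          congr 1
          have : 0 < α + 2 + n := by linarith
          field_simp

theorem pow_div_factorial_le_coeffWeight {α : ℝ} (hα : -1 < α) (n : ℕ) :
    (α + 2) ^ n / n.factorial ≤ coeffWeight α n := by
  induction n with
  | zero => simp [coeffWeight_zero hα]
  | succ k ih =>
    have hk : (0 : ℝ) ≤ k := k.cast_nonneg
    have h1 : 0 < α + 2 := by linarith
    have hγ := coeffWeight_pos hα k
    rw [coeffWeight_succ hα, Nat.factorial_succ, pow_succ]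
    push_cast
    calc (α + 2) ^ k * (α + 2) / ((k + 1) * k.factorial)
        = (α + 2) ^ k / k.factorial * ((α + 2) / (k + 1)) := by field_simp
      _ ≤ _ := by
        refine mul_le_mul ih ?_ (by positivity) hγ.le
        exact div_le_div_of_nonneg_right (by linarith) (by positivity)

/-- Bernoulli's inequality with exponent `B / 2`, squared. -/
theorem one_fourth_le_one_sub_inv_rpow {B : ℝ} (hB : 2 ≤ B) : 1 / 4 ≤ (1 - B⁻¹) ^ B := by
  have hB0 : 0 < B := by linarith
  have hBi : B⁻¹ ≤ 1 / 2 := by rw [inv_le_comm₀ hB0 (by norm_num)]; linarith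
  have h1 := one_add_mul_self_le_rpow_one_add (s := -B⁻¹) (by linarith) (p := B / 2) (by linarith)
  have h2 : 1 + B / 2 * -B⁻¹ = 1 / 2 := by field_simp; norm_num
  rw [h2, ← sub_eq_add_neg] at h1
  have h3 : (1 - B⁻¹) ^ B = ((1 - B⁻¹) ^ (B / 2)) ^ 2 := by
    rw [← Real.rpow_natCast, ← Real.rpow_mul (by linarith)]
    congr 1
    push_cast; ring
  rw [h3]
  nlinarith

section

variable {ψ : ℂ → ℂ} {g : ℝ → ℂ → ℂ}

theorem lintegral_normSq_of_windowCoeff {α : ℝ} (hα : -1 < α)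
    (hψ : ∑' n, ‖normalizedCoeff ψ n‖ₑ ^ 2 = 1) {g : ℂ → ℂ} (hg : Measurable g)
    (hb : HasDiscSeries (windowCoeff α ψ) g) : ∫⁻ ζ, ‖g ζ‖ₑ ^ 2 ∂(bergmanMeasure α) = 1 := by
  rw [hb.lintegral_normSq hg hα, ← hψ]
  simp_rw [enorm_windowCoeff_sq hα]

/-- The windows `V^α ψ` concentrate at the origin as `α → ∞`. -/
theorem tendsto_window_tail (hψ : ∑' n, ‖normalizedCoeff ψ n‖ₑ ^ 2 = 1)
    (hg : ∀ α, -1 < α → Measurable (g α))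
    (hb : ∀ α, -1 < α → HasDiscSeries (windowCoeff α ψ) (g α)) {ρ : ℝ} (hρ : 0 < ρ) :
    Tendsto (fun α => ∫⁻ ζ, (Set.Ici ρ).indicator 1 ‖ζ‖ * ‖g α ζ‖ₑ ^ 2 ∂(bergmanMeasure α))
      atTop (𝓝 0) := by
  have h0 : Tendsto (fun α : ℝ => ∑' n, ‖normalizedCoeff ψ n‖ₑ ^ 2 *
      min 1 (ENNReal.ofReal ((ρ ^ 2)⁻¹ * ((n + 1) / (α + 2 + n))))) atTop (𝓝 0) := by
    refine tendsto_tsum_mul_zero (by rw [hψ]; exact ENNReal.one_ne_top)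
      (Eventually.of_forall fun α n => min_le_left _ _) fun n => ?_
    have h1 : Tendsto (fun α : ℝ => (ρ ^ 2)⁻¹ * (((n : ℝ) + 1) / (α + 2 + n))) atTop (𝓝 0) := by
      have h2 : Tendsto (fun α : ℝ => α + 2 + (n : ℝ)) atTop atTop :=
        tendsto_atTop_add_const_right _ _ (tendsto_atTop_add_const_right _ _ tendsto_id)
      simpa using (tendsto_const_nhds.div_atTop h2).const_mul ((ρ ^ 2)⁻¹)
    have h3 := ENNReal.tendsto_ofReal h1
    rw [ENNReal.ofReal_zero] at h3
    exact tendsto_of_tendsto_of_tendsto_of_le_of_le tendsto_const_nhds h3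
      (fun _ => zero_le) fun _ => min_le_right _ _
  refine tendsto_of_tendsto_of_tendsto_of_le_of_le' tendsto_const_nhds h0
    (Eventually.of_forall fun _ => zero_le) ?_
  filter_upwards [eventually_gt_atTop (-1)] with α hα
  rw [(hb α hα).lintegral_radial_mul (hg α hα) α (measurable_one.indicator measurableSet_Ici)]
  refine ENNReal.tsum_le_tsum fun n => ?_
  have hγ := coeffWeight_pos hα n
  calc _ = ‖windowCoeff α ψ n‖ₑ ^ 2 * ENNReal.ofReal (coeffWeight α n)⁻¹ *
        (ENNReal.ofReal (coeffWeight α n) *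
          ∫⁻ ζ, (Set.Ici ρ).indicator 1 ‖ζ‖ * ‖ζ‖ₑ ^ (2 * n) ∂(bergmanMeasure α)) := by
        rw [mul_assoc, ← mul_assoc (ENNReal.ofReal _), ← ENNReal.ofReal_mul (inv_nonneg.2 hγ.le),
          inv_mul_cancel₀ hγ.ne', ENNReal.ofReal_one, one_mul]
    _ ≤ _ := by
        rw [enorm_windowCoeff_sq hα]
        exact mul_le_mul' le_rfl (setLIntegral_norm_pow_le hα hρ n)

/-- The mass that the kernel at `x` puts at distance at least `δ` from `x` is controlled by the mass
of the window at distance at least `δ / 4` from the origin. Half of `δ` is lost by passing from `w`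
to `φ_{-w}(r u)`, and half of the rest by undoing the Möbius shift at `x`. -/
theorem setLIntegral_berezinDensity_far_le (hψ : ∑' n, ‖normalizedCoeff ψ n‖ₑ ^ 2 = 1)
    {α : ℝ} (hα : 0 ≤ α) {g : ℂ → ℂ} (hg : Measurable g)
    (hb : HasDiscSeries (windowCoeff α ψ) g) {x : Circle × ℂ} (hx : x.2 ∈ disc)
    {δ : ℝ} (hαδ : 4 * √(α + 2)⁻¹ ≤ δ) :
    ∫⁻ y in Prod.snd ⁻¹' {w | δ ≤ ‖w - x.2‖}, berezinDensity α g x y ∂haarMeasureTD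
      ≤ ∑' n, ‖normalizedCoeff ψ n‖ₑ ^ 2 * min 1 (ENNReal.ofReal (4 * n.factorial) *
          ∫⁻ ζ, (Set.Ici (δ / 4)).indicator 1 ‖ζ‖ * ‖g ζ‖ₑ ^ 2 ∂(bergmanMeasure α)) := by
  have hα' : -1 < α := by linarith
  have hg1 := lintegral_normSq_of_windowCoeff hα' hψ hg hb
  have hhm : Measurable (moebiusShift α x.2 (rotate x.1 g)) :=
    measurable_moebiusShift α x.2 (measurable_rotate x.1 hg)
  have hhd : DifferentiableOn ℂ (moebiusShift α x.2 (rotate x.1 g)) disc :=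
    differentiableOn_moebiusShift α hx (hb.rotate x.1).differentiableOn
  have hh1 := lintegral_normSq_moebiusShift_rotate_univ hα' hg hx x.1
  rw [hg1] at hh1
  have hhfin : ∫⁻ ζ, ‖moebiusShift α x.2 (rotate x.1 g) ζ‖ₑ ^ 2 ∂(bergmanMeasure α) ≠ ∞ := by
    rw [hh1]; exact ENNReal.one_ne_top
  rw [setLIntegral_berezinDensity hα' hg hb hg1 hx]
  refine ENNReal.tsum_le_tsum fun n => ?_
  rw [enorm_windowCoeff_sq hα']
  refine mul_le_mul' le_rfl (le_min ?_ ?_)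
  · calc _ ≤ ENNReal.ofReal (α + 1) *
          ∫⁻ w, coeffMass α (moebiusShift α x.2 (rotate x.1 g)) n w ∂moebiusMeasure :=
          mul_le_mul' le_rfl (setLIntegral_le_lintegral _ _)
      _ = 1 := by rw [lintegral_coeffMass hα' hhm hhd hhfin, hh1]
  -- with `r² = 1 / (α + 2)` the factor `(1 - r²) ^ (α + 2) γ_n r ^ (2n)` is at least `1 / (4 n!)`,
  -- uniformly in `α`, while `r` still tends to zero
  set r := √(α + 2)⁻¹ with hr
  have hB : 0 < α + 2 := by linarith
  have hr0 : 0 ≤ r := Real.sqrt_nonneg _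
  have hr2 : r ^ 2 = (α + 2)⁻¹ := Real.sq_sqrt (by positivity)
  have hBi : (α + 2)⁻¹ < 1 := by rw [inv_lt_one₀ hB]; linarith
  have hr1 : r < 1 := by nlinarith
  have hE : MeasurableSet {w : ℂ | δ ≤ ‖w - x.2‖} := measurableSet_le (by fun_prop) (by fun_prop)
  have hE' : MeasurableSet {w : ℂ | δ / 2 ≤ ‖w - x.2‖} :=
    measurableSet_le (by fun_prop) (by fun_prop)
  have hrd : (r : ℂ) ∈ disc := by
    rw [mem_disc, Complex.norm_real, Real.norm_of_nonneg hr0]; exact hr1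
  have h1 := setLIntegral_coeffMass_le hα' hhm hhd hhfin hr0 hr1 hE hE' (fun w hwE hw u => by
    have h2 := norm_moebius_neg_sub_le hw ((circle_mul_mem_disc u).2 hrd)
    rw [norm_mul, Circle.norm_coe, one_mul, Complex.norm_real, Real.norm_of_nonneg hr0] at h2
    have h3 := norm_sub_le_norm_sub_add_norm_sub w (moebius (-w) (u * (r : ℂ))) x.2
    rw [norm_sub_rev w (moebius _ _)] at h3
    have h4 : δ ≤ ‖w - x.2‖ := hwE
    show δ / 2 ≤ _
    linarith) n
  have h2 : ∫⁻ ζ in {w : ℂ | δ / 2 ≤ ‖w - x.2‖}, ‖moebiusShift α x.2 (rotate x.1 g) ζ‖ₑ ^ 2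
      ∂(bergmanMeasure α)
      ≤ ∫⁻ ζ, (Set.Ici (δ / 4)).indicator 1 ‖ζ‖ * ‖g ζ‖ₑ ^ 2 ∂(bergmanMeasure α) := by
    refine le_trans (le_of_eq ?_) (lintegral_normSq_moebiusShift_rotate hα' hg hx x.1
      (k := {w : ℂ | δ / 2 ≤ ‖w - x.2‖}.indicator 1) (measurable_one.indicator hE')
      (measurable_one.indicator measurableSet_Ici) fun ζ hζ => ?_)
    · rw [← lintegral_indicator hE']
      congr 1
      ext w
      by_cases hw : w ∈ {w : ℂ | δ / 2 ≤ ‖w - x.2‖} <;> simp only [hw, Set.indicator_of_mem,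
        Set.indicator_of_notMem, not_false_eq_true, Pi.one_apply, one_mul, zero_mul]
    · have h3 := norm_moebius_neg_sub_le hx hζ
      by_cases hw : moebius (-x.2) ζ ∈ {w : ℂ | δ / 2 ≤ ‖w - x.2‖}
      · have hw' : δ / 2 ≤ ‖moebius (-x.2) ζ - x.2‖ := hw
        rw [Set.indicator_of_mem hw, Set.indicator_of_mem (Set.mem_Ici.2 (by linarith))]
        rfl
      · rw [Set.indicator_of_notMem hw]
        exact zero_le
  have hfac : (0 : ℝ) < 4 * n.factorial := by positivity
  have hlow : (4 * (n.factorial : ℝ))⁻¹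
      ≤ (1 - r ^ 2) ^ (α + 2) * (coeffWeight α n * (r ^ 2) ^ n) := by
    have h3 := pow_div_factorial_le_coeffWeight hα' n
    have h4 := one_fourth_le_one_sub_inv_rpow (B := α + 2) (by linarith)
    rw [hr2]
    calc (4 * (n.factorial : ℝ))⁻¹
        = 1 / 4 * ((α + 2) ^ n / n.factorial * ((α + 2)⁻¹) ^ n) := by
          rw [inv_pow]; field_simp
      _ ≤ _ := by gcongr
  have h3 := (mul_le_mul' (ENNReal.ofReal_le_ofReal hlow) le_rfl).trans (h1.trans h2)
  have h4 := mul_le_mul' (le_refl (ENNReal.ofReal (4 * n.factorial))) h3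
  rwa [← mul_assoc, ← ENNReal.ofReal_mul hfac.le, mul_inv_cancel₀ hfac.ne', ENNReal.ofReal_one,
    one_mul] at h4

/-- The kernel at `x` concentrates on the points over `x.2` as `α → ∞`. -/
theorem tendsto_setLIntegral_berezinDensity_far (hψ : ∑' n, ‖normalizedCoeff ψ n‖ₑ ^ 2 = 1)
    (hg : ∀ α, -1 < α → Measurable (g α))
    (hb : ∀ α, -1 < α → HasDiscSeries (windowCoeff α ψ) (g α)) {x : Circle × ℂ} (hx : x.2 ∈ disc)
    {δ : ℝ} (hδ : 0 < δ) :
    Tendsto (fun α => ∫⁻ y in Prod.snd ⁻¹' {w | δ ≤ ‖w - x.2‖}, berezinDensity α (g α) x y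
      ∂haarMeasureTD) atTop (𝓝 0) := by
  have h0 : Tendsto (fun α : ℝ => ∑' n, ‖normalizedCoeff ψ n‖ₑ ^ 2 *
      min 1 (ENNReal.ofReal (4 * n.factorial) *
        ∫⁻ ζ, (Set.Ici (δ / 4)).indicator 1 ‖ζ‖ * ‖g α ζ‖ₑ ^ 2 ∂(bergmanMeasure α)))
      atTop (𝓝 0) := by
    refine tendsto_tsum_mul_zero (by rw [hψ]; exact ENNReal.one_ne_top)
      (Eventually.of_forall fun α n => min_le_left _ _) fun n => ?_
    have h3 := ENNReal.Tendsto.const_mul (a := ENNReal.ofReal (4 * n.factorial))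
      (tendsto_window_tail hψ hg hb (ρ := δ / 4) (by positivity)) (Or.inr ENNReal.ofReal_ne_top)
    rw [mul_zero] at h3
    exact tendsto_of_tendsto_of_tendsto_of_le_of_le tendsto_const_nhds h3
      (fun _ => zero_le) fun _ => min_le_right _ _
  have h1 : Tendsto (fun α : ℝ => 4 * √(α + 2)⁻¹) atTop (𝓝 0) := by
    have h2 : Tendsto (fun α : ℝ => (α + 2)⁻¹) atTop (𝓝 0) :=
      tendsto_inv_atTop_zero.comp (tendsto_atTop_add_const_right _ _ tendsto_id)
    simpa using (h2.sqrt).const_mul 4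
  refine tendsto_of_tendsto_of_tendsto_of_le_of_le' tendsto_const_nhds h0
    (Eventually.of_forall fun _ => zero_le) ?_
  filter_upwards [eventually_ge_atTop 0, h1.eventually_le_const hδ] with α hα hαδ
  exact setLIntegral_berezinDensity_far_le hψ hα (hg α (by linarith)) (hb α (by linarith)) hx hαδ

end

/-! ### Symmetric Markov kernels on `L^p` -/

section Markov

variable {X : Type*} [MeasurableSpace X] {μ : Measure X} {k : X → X → ℝ≥0∞}

/-- A symmetric probability density with respect to `μ` in each of its variables. -/
structure IsSymmMarkovDensity (μ : Measure X) (k : X → X → ℝ≥0∞) : Prop where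
  measurable : Measurable (Function.uncurry k)
  symm : ∀ x y, k x y = k y x
  lintegral_eq_one : ∀ᵐ x ∂μ, ∫⁻ y, k x y ∂μ = 1

/-- The measure with density `k` on the product. For a symmetric Markov density both of its
marginals are `μ`. -/
def jointMeasure (μ : Measure X) (k : X → X → ℝ≥0∞) : Measure (X × X) :=
  (μ.prod μ).withDensity (Function.uncurry k)

namespace IsSymmMarkovDensity

theorem measurable_right (hk : IsSymmMarkovDensity μ k) (x : X) : Measurable (k x) :=
  hk.measurable.of_uncurry_left

variable [SigmaFinite μ]

theorem lintegral_jointMeasure (hk : IsSymmMarkovDensity μ k) {φ : X × X → ℝ≥0∞}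
    (hφ : Measurable φ) :
    ∫⁻ q, φ q ∂(jointMeasure μ k) = ∫⁻ x, ∫⁻ y, k x y * φ (x, y) ∂μ ∂μ := by
  rw [jointMeasure, lintegral_withDensity_eq_lintegral_mul _ hk.measurable hφ,
    lintegral_prod _ (hk.measurable.mul hφ).aemeasurable]
  rfl

theorem measurePreserving_fst (hk : IsSymmMarkovDensity μ k) :
    MeasurePreserving Prod.fst (jointMeasure μ k) μ := by
  refine ⟨measurable_fst, Measure.ext_of_lintegral _ fun g hg => ?_⟩
  rw [lintegral_map hg measurable_fst,
    hk.lintegral_jointMeasure (φ := fun q => g q.1) (hg.comp measurable_fst)]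
  refine lintegral_congr_ae ?_
  filter_upwards [hk.lintegral_eq_one] with x hx
  rw [lintegral_mul_const _ (hk.measurable_right x), hx, one_mul]

theorem lintegral_swap (hk : IsSymmMarkovDensity μ k) {φ : X × X → ℝ≥0∞} (hφ : Measurable φ) :
    ∫⁻ q, φ q.swap ∂(jointMeasure μ k) = ∫⁻ q, φ q ∂(jointMeasure μ k) := by
  have hm : Measurable fun q : X × X => k q.1 q.2 * φ q := hk.measurable.mul hφ
  rw [hk.lintegral_jointMeasure hφ,
    hk.lintegral_jointMeasure (φ := fun q => φ q.swap) (hφ.comp measurable_swap),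
    lintegral_lintegral_swap (f := fun x y => k x y * φ (x, y)) hm.aemeasurable]
  simp_rw [Prod.swap_prod_mk, hk.symm]

theorem measurePreserving_snd (hk : IsSymmMarkovDensity μ k) :
    MeasurePreserving Prod.snd (jointMeasure μ k) μ := by
  refine ⟨measurable_snd, Measure.ext_of_lintegral _ fun g hg => ?_⟩
  have h := hk.lintegral_swap (φ := fun q => g q.1) (hg.comp measurable_fst)
  rw [lintegral_map hg measurable_snd, ← hk.measurePreserving_fst.lintegral_comp hg, ← h]
  rfl

/-- Jensen's inequality for a symmetric Markov density: an average over the second variable has at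
most the `L^p` norm, with respect to the joint measure, of the averaged function. -/
theorem eLpNorm_le_of_enorm_le {E E' : Type*} [NormedAddCommGroup E] [NormedAddCommGroup E']
    (hk : IsSymmMarkovDensity μ k) {p : ℝ≥0∞} (hp1 : 1 ≤ p) (hp : p ≠ ∞) {F : X → E}
    {G : X × X → E'} (hG : StronglyMeasurable G)
    (hFG : ∀ᵐ x ∂μ, ‖F x‖ₑ ≤ ∫⁻ y, k x y * ‖G (x, y)‖ₑ ∂μ) :
    eLpNorm F p μ ≤ eLpNorm G p (jointMeasure μ k) := by
  have hp0 : p ≠ 0 := (zero_lt_one.trans_le hp1).ne'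
  have hpr : 1 ≤ p.toReal := by
    rw [← ENNReal.toReal_one]; exact ENNReal.toReal_mono hp hp1
  rw [eLpNorm_eq_lintegral_rpow_enorm_toReal hp0 hp, eLpNorm_eq_lintegral_rpow_enorm_toReal hp0 hp]
  refine ENNReal.rpow_le_rpow ?_ (by positivity)
  rw [hk.lintegral_jointMeasure (hG.enorm.pow_const _)]
  refine lintegral_mono_ae ?_
  filter_upwards [hFG, hk.lintegral_eq_one] with x hx hx1
  have hGx : Measurable fun y => ‖G (x, y)‖ₑ :=
    hG.enorm.comp (measurable_const.prodMk measurable_id)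
  have hkx := hk.measurable_right x
  have hprob : IsProbabilityMeasure (μ.withDensity (k x)) := ⟨by
    rw [withDensity_apply _ MeasurableSet.univ, Measure.restrict_univ, hx1]⟩
  have h := eLpNorm'_le_eLpNorm'_of_exponent_le one_pos hpr (μ.withDensity (k x))
    (f := fun y => ‖G (x, y)‖ₑ) hGx.aestronglyMeasurable
  simp only [eLpNorm', enorm_eq_self, ENNReal.rpow_one, div_one] at h
  rw [lintegral_withDensity_eq_lintegral_mul _ hkx hGx,
    lintegral_withDensity_eq_lintegral_mul _ hkx (hGx.pow_const _)] at h
  calc ‖F x‖ₑ ^ p.toReal ≤ (∫⁻ y, k x y * ‖G (x, y)‖ₑ ∂μ) ^ p.toReal :=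
        ENNReal.rpow_le_rpow hx (by positivity)
    _ ≤ ((∫⁻ y, k x y * ‖G (x, y)‖ₑ ^ p.toReal ∂μ) ^ (1 / p.toReal)) ^ p.toReal :=
        ENNReal.rpow_le_rpow h (by positivity)
    _ = _ := by
        rw [← ENNReal.rpow_mul, one_div, inv_mul_cancel₀ (by positivity), ENNReal.rpow_one]

/-- Replacing `f` by `g` in the oscillation costs twice the distance of `f` and `g`, since both
marginals of the joint measure are `μ`. -/
theorem eLpNorm_diff_le (hk : IsSymmMarkovDensity μ k) {p : ℝ≥0∞} (hp1 : 1 ≤ p)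
    {f g : X → ℂ} (hf : StronglyMeasurable f) (hg : StronglyMeasurable g) :
    eLpNorm (fun q : X × X => f q.2 - f q.1) p (jointMeasure μ k)
      ≤ eLpNorm (fun q : X × X => g q.2 - g q.1) p (jointMeasure μ k)
        + (eLpNorm (f - g) p μ + eLpNorm (f - g) p μ) := by
  have hfg := hf.sub hg
  have h1 : (fun q : X × X => f q.2 - f q.1)
      = (fun q : X × X => g q.2 - g q.1) + (((f - g) ∘ Prod.snd) - ((f - g) ∘ Prod.fst)) := by
    ext q
    simp only [Pi.add_apply, Pi.sub_apply, Function.comp_apply]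
    ring
  have hs := eLpNorm_comp_measurePreserving (p := p) hfg.aestronglyMeasurable
    hk.measurePreserving_snd
  have ht := eLpNorm_comp_measurePreserving (p := p) hfg.aestronglyMeasurable
    hk.measurePreserving_fst
  have m1 : StronglyMeasurable fun q : X × X => g q.2 - g q.1 :=
    (hg.comp_measurable measurable_snd).sub (hg.comp_measurable measurable_fst)
  have m2 : StronglyMeasurable ((f - g) ∘ Prod.snd : X × X → ℂ) :=
    hfg.comp_measurable measurable_snd
  have m3 : StronglyMeasurable ((f - g) ∘ Prod.fst : X × X → ℂ) :=
    hfg.comp_measurable measurable_fst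
  rw [h1]
  refine (eLpNorm_add_le m1.aestronglyMeasurable (m2.sub m3).aestronglyMeasurable hp1).trans ?_
  gcongr
  refine (eLpNorm_sub_le m2.aestronglyMeasurable m3.aestronglyMeasurable hp1).trans ?_
  rw [hs, ht]

/-- If `f` vanishes off `S`, only the pairs with a coordinate in `S` contribute to its oscillation,
and by symmetry the first coordinate may be taken in `S`. -/
theorem lintegral_diff_le (hk : IsSymmMarkovDensity μ k) {f : X → ℂ} (hf : StronglyMeasurable f)
    {S : Set X} (hS : MeasurableSet S) (hfS : ∀ x ∉ S, f x = 0) {p : ℝ} (hp : 0 < p) :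
    ∫⁻ q, ‖f q.2 - f q.1‖ₑ ^ p ∂(jointMeasure μ k)
      ≤ 2 * ∫⁻ x in S, ∫⁻ y, k x y * ‖f y - f x‖ₑ ^ p ∂μ ∂μ := by
  have hm : Measurable fun q : X × X => ‖f q.2 - f q.1‖ₑ ^ p :=
    ((hf.comp_measurable measurable_snd).sub (hf.comp_measurable measurable_fst)).enorm.pow_const _
  set φ : X × X → ℝ≥0∞ := fun q => S.indicator 1 q.1 * ‖f q.2 - f q.1‖ₑ ^ p with hφ
  have hφm : Measurable φ := ((measurable_one.indicator hS).comp measurable_fst).mul hm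
  have hle (q : X × X) : ‖f q.2 - f q.1‖ₑ ^ p ≤ φ q + φ q.swap := by
    simp only [hφ, Prod.fst_swap, Prod.snd_swap]
    rw [← enorm_neg (f q.1 - f q.2), neg_sub, ← add_mul]
    by_cases h1 : q.1 ∈ S
    · refine le_mul_of_one_le_left' ?_
      rw [Set.indicator_of_mem h1]
      exact le_self_add
    · by_cases h2 : q.2 ∈ S
      · refine le_mul_of_one_le_left' ?_
        rw [Set.indicator_of_mem h2]
        exact le_add_self
      · rw [hfS _ h1, hfS _ h2]
        simp [hp]
  calc ∫⁻ q, ‖f q.2 - f q.1‖ₑ ^ p ∂(jointMeasure μ k)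
      ≤ ∫⁻ q, φ q + φ q.swap ∂(jointMeasure μ k) := lintegral_mono hle
    _ = 2 * ∫⁻ q, φ q ∂(jointMeasure μ k) := by
        rw [lintegral_add_left hφm, hk.lintegral_swap hφm, two_mul]
    _ = _ := by
        rw [hk.lintegral_jointMeasure hφm, ← lintegral_indicator hS]
        congr 2
        ext x
        by_cases hx : x ∈ S <;> simp [hφ, hx]

end IsSymmMarkovDensity

/-- A family of symmetric Markov densities acts as an approximate identity on bounded functions
supported in a set of finite measure, as soon as the kernel at almost every point concentrates
where the function is nearly constant. The hypothesis `hmass` is not part of `hk`, since the null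
sets in `hk` may depend on the index, which ranges over an uncountable set. -/
theorem tendsto_eLpNorm_diff_of_bounded [SigmaFinite μ] {k : ℝ → X → X → ℝ≥0∞}
    (hk : ∀ᶠ α in atTop, IsSymmMarkovDensity μ (k α)) {p : ℝ≥0∞} (hp1 : 1 ≤ p) (hp : p ≠ ∞)
    {f : X → ℂ} (hf : StronglyMeasurable f) {M : ℝ} (hM : ∀ x, ‖f x‖ ≤ M) {S : Set X}
    (hS : MeasurableSet S) (hSfin : μ S ≠ ∞) (hfS : ∀ x ∉ S, f x = 0)
    (hmass : ∀ᵐ x ∂μ, ∀ᶠ α in atTop, ∫⁻ y, k α x y ∂μ = 1)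
    (hconc : ∀ᵐ x ∂μ, ∀ ε : ℝ, 0 < ε →
      Tendsto (fun α => ∫⁻ y in {y | ε ≤ ‖f y - f x‖}, k α x y ∂μ) atTop (𝓝 0)) :
    Tendsto (fun α => eLpNorm (fun q : X × X => f q.2 - f q.1) p (jointMeasure μ (k α)))
      atTop (𝓝 0) := by
  have hp0 : p ≠ 0 := (zero_lt_one.trans_le hp1).ne'
  have hpr : 1 ≤ p.toReal := by
    rw [← ENNReal.toReal_one]; exact ENNReal.toReal_mono hp hp1
  have hpr0 : 0 < p.toReal := by positivity
  set C : ℝ≥0∞ := ENNReal.ofReal (2 * M) ^ p.toReal with hC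
  have hCfin : C ≠ ∞ := ENNReal.rpow_ne_top_of_nonneg hpr0.le ENNReal.ofReal_ne_top
  have hbound (x y : X) : ‖f y - f x‖ₑ ^ p.toReal ≤ C := by
    refine ENNReal.rpow_le_rpow ?_ hpr0.le
    rw [← ofReal_norm]
    refine ENNReal.ofReal_le_ofReal ((norm_sub_le _ _).trans ?_)
    linarith [hM x, hM y]
  set J : ℝ → X → ℝ≥0∞ := fun α x => ∫⁻ y, k α x y * ‖f y - f x‖ₑ ^ p.toReal ∂μ with hJ
  have hdiff : Measurable fun q : X × X => ‖f q.2 - f q.1‖ₑ ^ p.toReal :=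
    ((hf.comp_measurable measurable_snd).sub (hf.comp_measurable measurable_fst)).enorm.pow_const _
  have hJC : ∀ᶠ α in atTop, ∀ᵐ x ∂(μ.restrict S), J α x ≤ C := by
    filter_upwards [hk] with α hα
    filter_upwards [ae_restrict_of_ae hα.lintegral_eq_one] with x hx
    calc J α x ≤ ∫⁻ y, k α x y * C ∂μ :=
          lintegral_mono fun y => mul_le_mul' le_rfl (hbound x y)
      _ = C := by rw [lintegral_mul_const _ (hα.measurable_right x), hx, one_mul]
  have hJ0 : ∀ᵐ x ∂μ, Tendsto (fun α => J α x) atTop (𝓝 0) := by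
    filter_upwards [hmass, hconc] with x hx1 hx
    rw [ENNReal.tendsto_nhds_zero]
    intro η hη
    have hη2 : 0 < η / 2 := ENNReal.half_pos hη.ne'
    obtain ⟨ε, hε, hε0⟩ : ∃ ε : ℝ, ENNReal.ofReal ε ^ p.toReal ≤ η / 2 ∧ 0 < ε := by
      have h1 : Tendsto (fun ε : ℝ => ENNReal.ofReal ε ^ p.toReal) (𝓝[>] 0) (𝓝 0) := by
        have h2 : Continuous fun ε : ℝ => ENNReal.ofReal ε ^ p.toReal :=
          ENNReal.continuous_rpow_const.comp ENNReal.continuous_ofReal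
        have h3 := h2.tendsto 0
        rw [ENNReal.ofReal_zero, ENNReal.zero_rpow_of_pos hpr0] at h3
        exact h3.mono_left nhdsWithin_le_nhds
      exact ((h1.eventually_le_const hη2).and self_mem_nhdsWithin).exists
    have h1 := ENNReal.Tendsto.mul_const (b := C) (hx ε hε0) (Or.inr hCfin)
    rw [zero_mul] at h1
    filter_upwards [hk, hx1, h1.eventually_le_const hη2] with α hα hα1 hα2
    have hE : MeasurableSet {y | ε ≤ ‖f y - f x‖} :=
      measurableSet_le measurable_const (hf.sub stronglyMeasurable_const).norm.measurable
    have hkx := hα.measurable_right x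
    calc J α x ≤ ∫⁻ y, k α x y * ENNReal.ofReal ε ^ p.toReal
          + {y | ε ≤ ‖f y - f x‖}.indicator (k α x) y * C ∂μ := by
          refine lintegral_mono fun y => ?_
          by_cases hy : y ∈ {y | ε ≤ ‖f y - f x‖}
          · rw [Set.indicator_of_mem hy]
            exact (mul_le_mul' le_rfl (hbound x y)).trans le_add_self
          · rw [Set.indicator_of_notMem hy, zero_mul, add_zero]
            refine mul_le_mul' le_rfl (ENNReal.rpow_le_rpow ?_ hpr0.le)
            rw [← ofReal_norm]
            exact ENNReal.ofReal_le_ofReal (not_le.1 hy).le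
      _ = ENNReal.ofReal ε ^ p.toReal + (∫⁻ y in {y | ε ≤ ‖f y - f x‖}, k α x y ∂μ) * C := by
          rw [lintegral_add_left (hkx.mul_const _), lintegral_mul_const _ hkx, hα1, one_mul,
            lintegral_mul_const _ (hkx.indicator hE), lintegral_indicator hE]
      _ ≤ η / 2 + η / 2 := add_le_add hε hα2
      _ = η := ENNReal.add_halves η
  have hint : Tendsto (fun α => ∫⁻ x in S, J α x ∂μ) atTop (𝓝 0) := by
    have h := tendsto_lintegral_filter_of_dominated_convergence (μ := μ.restrict S)
      (l := (atTop : Filter ℝ)) (F := J) (f := fun _ => 0) (fun _ => C)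
      (hk.mono fun α hα => (Measurable.lintegral_prod_right'
        (f := fun q : X × X => k α q.1 q.2 * ‖f q.2 - f q.1‖ₑ ^ p.toReal)
        (hα.measurable.mul hdiff))) hJC
      (by simpa using ENNReal.mul_ne_top hCfin hSfin)
      (ae_restrict_of_ae hJ0)
    simpa using h
  have htotal : Tendsto (fun α => ∫⁻ q, ‖f q.2 - f q.1‖ₑ ^ p.toReal ∂(jointMeasure μ (k α)))
      atTop (𝓝 0) := by
    have h2 := ENNReal.Tendsto.const_mul (a := 2) hint (Or.inr ENNReal.ofNat_ne_top)
    rw [mul_zero] at h2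
    refine tendsto_of_tendsto_of_tendsto_of_le_of_le' tendsto_const_nhds h2
      (Eventually.of_forall fun _ => zero_le) ?_
    filter_upwards [hk] with α hα
    exact hα.lintegral_diff_le hf hS hfS hpr0
  have h3 := ((ENNReal.continuous_rpow_const (y := 1 / p.toReal)).tendsto 0).comp htotal
  rw [ENNReal.zero_rpow_of_pos (by positivity)] at h3
  refine h3.congr fun α => ?_
  rw [eLpNorm_eq_lintegral_rpow_enorm_toReal hp0 hp]
  rfl

end Markov

/-! ### A dense class of functions on the disc -/

theorem moebiusMeasure_ball_lt_top {R : ℝ} (hR0 : 0 ≤ R) (hR : R < 1) :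
    moebiusMeasure (Metric.ball 0 R) < ∞ := by
  rw [← setLIntegral_one, ← lintegral_indicator Metric.isOpen_ball.measurableSet,
    lintegral_moebiusMeasure (measurable_const.indicator Metric.isOpen_ball.measurableSet)]
  have hR2 : 0 < 1 - R ^ 2 := by nlinarith
  calc _ ≤ ∫⁻ _ in disc, ENNReal.ofReal (1 / (Real.pi * (1 - R ^ 2) ^ 2)) := by
        refine lintegral_mono fun z => ?_
        by_cases hz : z ∈ Metric.ball (0 : ℂ) R
        · rw [Set.indicator_of_mem hz, mul_one]
          rw [mem_ball_zero_iff] at hz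
          have h1 : 1 - R ^ 2 ≤ 1 - ‖z‖ ^ 2 := by nlinarith [norm_nonneg z]
          refine ENNReal.ofReal_le_ofReal ?_
          gcongr
        · rw [Set.indicator_of_notMem hz, mul_zero]
          exact zero_le
    _ < ∞ := by
        rw [setLIntegral_const]
        exact ENNReal.mul_lt_top ENNReal.ofReal_lt_top measure_ball_lt_top

/-- Bounded functions that vanish off a smaller disc and are continuous off a null set are dense
in `L^p` of the Möbius measure. -/
theorem exists_bounded_eLpNorm_sub_le {p : ℝ≥0∞} (hp1 : 1 ≤ p) (hp : p ≠ ∞) {f : ℂ → ℂ}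
    (hfm : StronglyMeasurable f) (hf : MemLp f p moebiusMeasure) {ε : ℝ≥0∞} (hε : ε ≠ 0) :
    ∃ g : ℂ → ℂ, StronglyMeasurable g ∧ eLpNorm (f - g) p moebiusMeasure ≤ ε ∧
      (∃ M : ℝ, ∀ z, ‖g z‖ ≤ M) ∧
      (∃ R : ℝ, 0 ≤ R ∧ R < 1 ∧ ∀ z ∉ Metric.ball 0 R, g z = 0) ∧
      ∀ᵐ z ∂moebiusMeasure, ContinuousAt g z := by
  have hp0 : p ≠ 0 := (zero_lt_one.trans_le hp1).ne'
  have hpr0 : 0 < p.toReal := ENNReal.toReal_pos hp0 hp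
  have hε2 : ε / 2 ≠ 0 := (ENNReal.half_pos hε).ne'
  set R : ℕ → ℝ := fun n => 1 - 1 / ((n : ℝ) + 1) with hRdef
  have hRlim : Tendsto R atTop (𝓝 1) := by
    simpa [hRdef] using (tendsto_one_div_add_atTop_nhds_zero_nat (𝕜 := ℝ)).const_sub (1 : ℝ)
  have hR0 (n : ℕ) : 0 ≤ R n := by
    rw [hRdef, sub_nonneg, div_le_one (by positivity)]
    linarith [n.cast_nonneg (α := ℝ)]
  have hR1 (n : ℕ) : R n < 1 := by
    have : 0 < 1 / ((n : ℝ) + 1) := by positivity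
    simp only [hRdef]; linarith
  have hB (n : ℕ) : MeasurableSet (Metric.ball (0 : ℂ) (R n)) := Metric.isOpen_ball.measurableSet
  -- truncation to a smaller disc
  have htrunc : Tendsto (fun n => eLpNorm (f - (Metric.ball 0 (R n)).indicator f) p moebiusMeasure)
      atTop (𝓝 0) := by
    have h1 : Tendsto (fun n => ∫⁻ z, ‖(f - (Metric.ball 0 (R n)).indicator f) z‖ₑ ^ p.toReal
        ∂moebiusMeasure) atTop (𝓝 0) := by
      have h := tendsto_lintegral_of_dominated_convergence (μ := moebiusMeasure)
        (F := fun n z => ‖(f - (Metric.ball 0 (R n)).indicator f) z‖ₑ ^ p.toReal)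
        (f := fun _ => 0) (fun z => ‖f z‖ₑ ^ p.toReal)
        (fun n => (hfm.sub (hfm.indicator (hB n))).enorm.pow_const _)
        (fun n => ae_of_all _ fun z => by
          refine ENNReal.rpow_le_rpow ?_ hpr0.le
          by_cases hz : z ∈ Metric.ball (0 : ℂ) (R n)
          · rw [Pi.sub_apply, Set.indicator_of_mem hz, sub_self, enorm_zero]
            exact zero_le
          · rw [Pi.sub_apply, Set.indicator_of_notMem hz, sub_zero])
        (lintegral_rpow_enorm_lt_top_of_eLpNorm_lt_top hp0 hp hf.2).ne
        (by
          filter_upwards [ae_mem_disc] with z hz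
          refine tendsto_const_nhds.congr' ?_
          filter_upwards [hRlim.eventually_const_lt (mem_disc.1 hz)] with n hn
          rw [Pi.sub_apply, Set.indicator_of_mem (mem_ball_zero_iff.2 hn), sub_self, enorm_zero,
            ENNReal.zero_rpow_of_pos hpr0])
      simpa using h
    have h3 := ((ENNReal.continuous_rpow_const (y := 1 / p.toReal)).tendsto 0).comp h1
    rw [ENNReal.zero_rpow_of_pos (by positivity)] at h3
    refine h3.congr fun n => ?_
    rw [eLpNorm_eq_lintegral_rpow_enorm_toReal hp0 hp]
    rfl
  obtain ⟨n, hn⟩ := (htrunc.eventually_le_const (pos_iff_ne_zero.2 hε2)).exists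
  have hfinite : IsFiniteMeasure (moebiusMeasure.restrict (Metric.ball 0 (R n))) :=
    ⟨by rw [Measure.restrict_apply_univ]; exact moebiusMeasure_ball_lt_top (hR0 n) (hR1 n)⟩
  -- continuous functions are dense with respect to the finite restricted measure
  obtain ⟨g, hg, -⟩ := (hf.restrict (Metric.ball 0 (R n))).exists_boundedContinuous_eLpNorm_sub_le
    hp hε2
  have hgm : StronglyMeasurable g := g.continuous.stronglyMeasurable
  refine ⟨(Metric.ball 0 (R n)).indicator g, hgm.indicator (hB n), ?_, ⟨‖g‖, fun z => ?_⟩,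
    ⟨R n, hR0 n, hR1 n, fun z hz => Set.indicator_of_notMem hz _⟩, ?_⟩
  · set B := Metric.ball (0 : ℂ) (R n) with hBdef
    have h1 : f - B.indicator g = (f - B.indicator f) + B.indicator (f - ⇑g) := by
      rw [Set.indicator_sub']
      abel
    have h2 : eLpNorm (B.indicator (f - ⇑g)) p moebiusMeasure ≤ ε / 2 := by
      rwa [eLpNorm_indicator_eq_eLpNorm_restrict (hB n)]
    rw [h1, ← ENNReal.add_halves ε]
    exact (eLpNorm_add_le (hfm.sub (hfm.indicator (hB n))).aestronglyMeasurable
      ((hfm.sub hgm).indicator (hB n)).aestronglyMeasurable hp1).trans (add_le_add hn h2)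
  · exact (norm_indicator_le_norm_self _ _).trans (g.norm_coe_le_norm z)
  -- the truncation of a continuous function is continuous off the boundary circle
  · have hac : moebiusMeasure ≪ volume :=
      (withDensity_absolutelyContinuous _ _).trans Measure.absolutelyContinuous_restrict
    have hsph : moebiusMeasure (Metric.sphere 0 (R n)) = 0 :=
      hac (Measure.addHaar_sphere volume 0 (R n))
    filter_upwards [measure_eq_zero_iff_ae_notMem.1 hsph] with z hz
    have hz' : z ∉ frontier (Metric.ball (0 : ℂ) (R n)) := fun h =>
      hz (Metric.frontier_ball_subset_sphere h)
    exact g.continuous.continuousOn.continuousAt_indicator hz'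

/-! ### The windowed Berezin transform -/

theorem measurePreserving_snd_haarMeasureTD :
    MeasurePreserving Prod.snd haarMeasureTD moebiusMeasure := by
  unfold haarMeasureTD; exact measurePreserving_snd

theorem memLp_liftTD {p : ℝ≥0∞} {f : ℂ → ℂ} (hf : MemLp f p moebiusMeasure) :
    MemLp (liftTD f) p haarMeasureTD :=
  hf.comp_measurePreserving measurePreserving_snd_haarMeasureTD

theorem isSymmMarkovDensity_berezinDensity {α : ℝ} {g : ℂ → ℂ} {b : ℕ → ℂ} (hα : -1 < α)
    (hg : Measurable g) (hb : HasDiscSeries b g)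
    (hg1 : ∫⁻ ζ, ‖g ζ‖ₑ ^ 2 ∂(bergmanMeasure α) = 1) :
    IsSymmMarkovDensity haarMeasureTD (berezinDensity α g) where
  measurable := measurable_berezinDensity α hg
  symm := berezinDensity_comm α g
  lintegral_eq_one := by
    filter_upwards [ae_snd_mem_disc] with x hx
    exact lintegral_berezinDensity hα hg hb hg1 hx

theorem berezinKernel_nonneg (α : ℝ) (g : ℂ → ℂ) (x y : Circle × ℂ) :
    0 ≤ berezinKernel α g x y := by
  unfold berezinKernel; positivity

theorem enorm_berezinKernel {α : ℝ} (hα : -1 < α) (g : ℂ → ℂ) (x y : Circle × ℂ) :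
    ‖(((α + 1) * berezinKernel α g x y : ℝ) : ℂ)‖ₑ = berezinDensity α g x y := by
  have h1 : 0 ≤ α + 1 := by linarith
  rw [← ofReal_berezinKernel hα, ← ofReal_norm, Complex.norm_real,
    Real.norm_of_nonneg (mul_nonneg h1 (berezinKernel_nonneg α g x y))]

/-- The bound that makes a function in `L^p` integrable against a bounded integrable kernel. -/
theorem le_rpow_add_one (t : ℝ≥0∞) {q : ℝ} (hq : 1 ≤ q) : t ≤ t ^ q + 1 := by
  rcases le_total t 1 with h | h
  · exact h.trans le_add_self
  · calc t = t ^ (1 : ℝ) := (ENNReal.rpow_one t).symm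
      _ ≤ t ^ q := ENNReal.rpow_le_rpow_of_exponent_le h hq
      _ ≤ _ := le_self_add

section

variable {α : ℝ} {g : ℂ → ℂ} {b : ℕ → ℂ} {p : ℝ≥0∞}

/-- The kernel is bounded and integrable, so that it may be integrated against any function in
`L^p`. -/
theorem integrable_mul_berezinKernel (hα : -1 < α) (hg : Measurable g) (hb : HasDiscSeries b g)
    (hg1 : ∫⁻ ζ, ‖g ζ‖ₑ ^ 2 ∂(bergmanMeasure α) = 1) (hp1 : 1 ≤ p) (hp : p ≠ ∞)
    {F : Circle × ℂ → ℂ} (hF : MemLp F p haarMeasureTD) {x : Circle × ℂ} (hx : x.2 ∈ disc) :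
    Integrable (fun y => F y * (((α + 1) * berezinKernel α g x y : ℝ) : ℂ)) haarMeasureTD := by
  have hp0 : p ≠ 0 := (zero_lt_one.trans_le hp1).ne'
  have hpr : 1 ≤ p.toReal := by
    rw [← ENNReal.toReal_one]; exact ENNReal.toReal_mono hp hp1
  have hK : Measurable fun y => berezinKernel α g x y :=
    (measurable_berezinKernel α hg).of_uncurry_left
  have hk := measurable_berezinDensity_right α hg x
  have hKc : Measurable fun y => (((α + 1) * berezinKernel α g x y : ℝ) : ℂ) := by fun_prop
  refine ⟨hF.1.mul hKc.aestronglyMeasurable, ?_⟩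
  rw [HasFiniteIntegral]
  calc ∫⁻ y, ‖F y * (((α + 1) * berezinKernel α g x y : ℝ) : ℂ)‖ₑ ∂haarMeasureTD
      ≤ ∫⁻ y, ‖F y‖ₑ ^ p.toReal * ENNReal.ofReal (α + 1) + berezinDensity α g x y
          ∂haarMeasureTD := by
        refine lintegral_mono_ae ?_
        filter_upwards [ae_snd_mem_disc] with y hy
        rw [enorm_mul, enorm_berezinKernel hα]
        calc ‖F y‖ₑ * berezinDensity α g x y
            ≤ (‖F y‖ₑ ^ p.toReal + 1) * berezinDensity α g x y :=
              mul_le_mul' (le_rpow_add_one _ hpr) le_rfl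
          _ = ‖F y‖ₑ ^ p.toReal * berezinDensity α g x y + berezinDensity α g x y := by
              rw [add_mul, one_mul]
          _ ≤ _ := add_le_add (mul_le_mul' le_rfl (berezinDensity_le hα hg hg1 hx hy)) le_rfl
    _ < ∞ := by
        rw [lintegral_add_right _ hk, lintegral_mul_const' _ _ ENNReal.ofReal_ne_top,
          lintegral_berezinDensity hα hg hb hg1 hx]
        exact ENNReal.add_lt_top.2 ⟨ENNReal.mul_lt_top
          (lintegral_rpow_enorm_lt_top_of_eLpNorm_lt_top hp0 hp hF.2) ENNReal.ofReal_lt_top,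
          ENNReal.one_lt_top⟩

theorem integral_berezinKernel (hα : -1 < α) (hg : Measurable g) (hb : HasDiscSeries b g)
    (hg1 : ∫⁻ ζ, ‖g ζ‖ₑ ^ 2 ∂(bergmanMeasure α) = 1) {x : Circle × ℂ} (hx : x.2 ∈ disc) :
    Integrable (fun y => (((α + 1) * berezinKernel α g x y : ℝ) : ℂ)) haarMeasureTD ∧
      ∫ y, (((α + 1) * berezinKernel α g x y : ℝ) : ℂ) ∂haarMeasureTD = 1 := by
  have h1 : 0 ≤ α + 1 := by linarith
  have hK : Measurable fun y => berezinKernel α g x y :=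
    (measurable_berezinKernel α hg).of_uncurry_left
  have hm := lintegral_berezinDensity hα hg hb hg1 hx
  constructor
  · refine ⟨Measurable.aestronglyMeasurable (by fun_prop), ?_⟩
    rw [HasFiniteIntegral]
    simp_rw [enorm_berezinKernel hα]
    rw [hm]
    exact ENNReal.one_lt_top
  · rw [integral_complex_ofReal, integral_eq_lintegral_of_nonneg_ae
      (ae_of_all _ fun y => mul_nonneg h1 (berezinKernel_nonneg α g x y))
      (Measurable.aestronglyMeasurable (by fun_prop))]
    simp_rw [ofReal_berezinKernel hα, hm]
    simp

/-- The Berezin transform as a single integral against the normalized kernel. -/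
def kernelIntegral (α : ℝ) (g : ℂ → ℂ) (F : Circle × ℂ → ℂ) (x : Circle × ℂ) : ℂ :=
  ∫ y, F y * (((α + 1) * berezinKernel α g x y : ℝ) : ℂ) ∂haarMeasureTD

theorem stronglyMeasurable_kernelIntegral (α : ℝ) (hg : Measurable g) {F : Circle × ℂ → ℂ}
    (hF : StronglyMeasurable F) : StronglyMeasurable (kernelIntegral α g F) := by
  have hK := measurable_berezinKernel α hg
  have h : Measurable fun q : (Circle × ℂ) × (Circle × ℂ) =>
      F q.2 * (((α + 1) * berezinKernel α g q.1 q.2 : ℝ) : ℂ) :=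
    (hF.measurable.comp measurable_snd).mul (by fun_prop)
  exact h.stronglyMeasurable.integral_prod_right'

theorem enorm_kernelIntegral_le (hα : -1 < α) (g : ℂ → ℂ) (F : Circle × ℂ → ℂ) (x : Circle × ℂ) :
    ‖kernelIntegral α g F x‖ₑ ≤ ∫⁻ y, berezinDensity α g x y * ‖F y‖ₑ ∂haarMeasureTD := by
  refine (enorm_integral_le_lintegral_enorm _).trans_eq ?_
  simp_rw [enorm_mul, enorm_berezinKernel hα, mul_comm]

/-- The kernel integrates to one, so `F x` may be taken under the integral. -/
theorem enorm_kernelIntegral_sub_le (hα : -1 < α) (hg : Measurable g) (hb : HasDiscSeries b g)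
    (hg1 : ∫⁻ ζ, ‖g ζ‖ₑ ^ 2 ∂(bergmanMeasure α) = 1) (hp1 : 1 ≤ p) (hp : p ≠ ∞)
    {F : Circle × ℂ → ℂ} (hF : MemLp F p haarMeasureTD) {x : Circle × ℂ} (hx : x.2 ∈ disc) :
    ‖kernelIntegral α g F x - F x‖ₑ
      ≤ ∫⁻ y, berezinDensity α g x y * ‖F y - F x‖ₑ ∂haarMeasureTD := by
  obtain ⟨h1, h2⟩ := integral_berezinKernel hα hg hb hg1 hx
  have h3 := integrable_mul_berezinKernel hα hg hb hg1 hp1 hp hF hx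
  have h4 : kernelIntegral α g F x - F x = kernelIntegral α g (fun y => F y - F x) x := by
    unfold kernelIntegral
    simp_rw [sub_mul]
    rw [integral_sub h3 (h1.const_mul _), integral_const_mul, h2, mul_one]
  rw [h4]
  exact enorm_kernelIntegral_le hα g _ x

/-- The iterated integral that defines the windowed Berezin transform converges absolutely and
equals the integral against the normalized kernel. The measurable window `g` is allowed to differ
from `g'` off the disc. -/
theorem windowedBerezin_eq_kernelIntegral {g' : ℂ → ℂ} (hgg' : ∀ z ∈ disc, g' z = g z)
    (hα : -1 < α) (hg : Measurable g) (hb : HasDiscSeries b g)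
    (hg1 : ∫⁻ ζ, ‖g ζ‖ₑ ^ 2 ∂(bergmanMeasure α) = 1) (hp1 : 1 ≤ p) (hp : p ≠ ∞)
    {F : Circle × ℂ → ℂ} (hF : MemLp F p haarMeasureTD) {x : Circle × ℂ} (hx : x.2 ∈ disc) :
    Integrable (fun y => F y * (berezinKernel α g' x y : ℂ)) haarMeasureTD ∧
      windowedBerezin α g' F x = kernelIntegral α g F x := by
  have hα0 : ((α + 1 : ℝ) : ℂ) ≠ 0 := by
    have : (α + 1 : ℝ) ≠ 0 := by linarith
    exact_mod_cast this
  have hK : ∀ᵐ y ∂haarMeasureTD, ((α + 1 : ℝ) : ℂ) * (F y * (berezinKernel α g' x y : ℂ))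
      = F y * (((α + 1) * berezinKernel α g x y : ℝ) : ℂ) := by
    filter_upwards [ae_snd_mem_disc] with y hy
    rw [berezinKernel_congr α hgg' hx hy]
    push_cast
    ring
  have hint : Integrable (fun y => F y * (berezinKernel α g' x y : ℂ)) haarMeasureTD := by
    have h := (integrable_mul_berezinKernel hα hg hb hg1 hp1 hp hF hx).const_mul
      ((α + 1 : ℝ) : ℂ)⁻¹
    refine h.congr ?_
    filter_upwards [hK] with y hy
    rw [← hy, inv_mul_cancel_left₀ hα0]
  refine ⟨hint, ?_⟩
  rw [windowedBerezin, kernelIntegral, ← integral_congr_ae hK, integral_const_mul]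
  congr 1
  exact (integral_prod _ hint).symm

end

/-- The oscillation of a function in `L^p` with respect to the kernel tends to zero: the bounded
case and density. -/
theorem tendsto_eLpNorm_diff_berezinDensity {ψ : ℂ → ℂ} {g : ℝ → ℂ → ℂ}
    (hψ : ∑' n, ‖normalizedCoeff ψ n‖ₑ ^ 2 = 1)
    (hg : ∀ α, -1 < α → Measurable (g α))
    (hb : ∀ α, -1 < α → HasDiscSeries (windowCoeff α ψ) (g α)) {p : ℝ≥0∞} (hp1 : 1 ≤ p)
    (hp : p ≠ ∞) {f : ℂ → ℂ} (hfm : StronglyMeasurable f) (hf : MemLp f p moebiusMeasure) :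
    Tendsto (fun α => eLpNorm (fun q : (Circle × ℂ) × (Circle × ℂ) => liftTD f q.2 - liftTD f q.1)
      p (jointMeasure haarMeasureTD (berezinDensity α (g α)))) atTop (𝓝 0) := by
  have hg1 (α : ℝ) (hα : -1 < α) := lintegral_normSq_of_windowCoeff hα hψ (hg α hα) (hb α hα)
  have hk (α : ℝ) (hα : -1 < α) :=
    isSymmMarkovDensity_berezinDensity hα (hg α hα) (hb α hα) (hg1 α hα)
  have hlift {f : ℂ → ℂ} (hf : StronglyMeasurable f) : StronglyMeasurable (liftTD f) :=
    hf.comp_measurable measurable_snd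
  rw [ENNReal.tendsto_nhds_zero]
  intro η hη
  have hη2 : 0 < η / 2 := ENNReal.half_pos hη.ne'
  have hη4 : η / 2 / 2 ≠ 0 := (ENNReal.half_pos hη2.ne').ne'
  obtain ⟨f', hf'm, hff', ⟨M, hM⟩, ⟨R, hR0, hR1, hR⟩, hcont⟩ :=
    exists_bounded_eLpNorm_sub_le hp1 hp hfm hf hη4
  have hS : MeasurableSet (Prod.snd ⁻¹' Metric.ball 0 R : Set (Circle × ℂ)) :=
    measurable_snd Metric.isOpen_ball.measurableSet
  have hlim := tendsto_eLpNorm_diff_of_bounded (μ := haarMeasureTD)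
    (k := fun α => berezinDensity α (g α)) ((eventually_gt_atTop (-1)).mono hk) hp1 hp
    (hlift hf'm) (fun x => hM x.2) hS
    (by
      rw [measurePreserving_snd_haarMeasureTD.measure_preimage
        Metric.isOpen_ball.measurableSet.nullMeasurableSet]
      exact (moebiusMeasure_ball_lt_top hR0 hR1).ne)
    (fun x hx => hR x.2 hx)
    (by
      filter_upwards [ae_snd_mem_disc] with x hx
      filter_upwards [eventually_gt_atTop (-1)] with α hα
      exact lintegral_berezinDensity hα (hg α hα) (hb α hα) (hg1 α hα) hx)
    (by
      filter_upwards [ae_snd_mem_disc,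
        measurePreserving_snd_haarMeasureTD.quasiMeasurePreserving.ae hcont] with x hx hxc ε hε
      obtain ⟨δ, hδ, hδε⟩ := Metric.continuousAt_iff.1 hxc ε hε
      refine tendsto_of_tendsto_of_tendsto_of_le_of_le tendsto_const_nhds
        (tendsto_setLIntegral_berezinDensity_far hψ hg hb hx hδ) (fun _ => zero_le) fun α => ?_
      refine lintegral_mono_set fun y hy => ?_
      by_contra hlt
      have h1 : dist y.2 x.2 < δ := by
        rw [dist_eq_norm]
        exact not_le.1 hlt
      have h2 := hδε h1
      rw [dist_eq_norm] at h2
      exact absurd hy (not_le.2 h2))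
  filter_upwards [hlim.eventually_le_const hη2, eventually_gt_atTop (-1)] with α hα hα1
  refine ((hk α hα1).eLpNorm_diff_le hp1 (hlift hfm) (hlift hf'm)).trans ?_
  have h1 : eLpNorm (liftTD f - liftTD f') p haarMeasureTD ≤ η / 2 / 2 := by
    have h2 := eLpNorm_comp_measurePreserving (p := p) (hfm.sub hf'm).aestronglyMeasurable
      measurePreserving_snd_haarMeasureTD
    exact h2.trans_le hff'
  calc _ ≤ η / 2 + (η / 2 / 2 + η / 2 / 2) := add_le_add hα (add_le_add h1 h1)
    _ = η := by rw [ENNReal.add_halves, ENNReal.add_halves]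

end BergmanWindow

end

open BergmanWindow in
theorem theorem5p4 (ψ : ℂ → ℂ) (hψ : MemBergman 0 ψ) (hψ1 : bergmanNorm 0 ψ = 1)
    (p : ℝ≥0∞) (hp1 : 1 ≤ p) (hp : p ≠ ∞)
    (f : ℂ → ℂ) (hf : MemLp f p moebiusMeasure) :
    (∀ α : ℝ, -1 < α →
      (∀ u : Circle, ∀ z ∈ disc,
        Integrable (fun b => liftTD f b * (berezinKernel α (fracDiff α ψ) (u, z) b : ℂ))
          haarMeasureTD) ∧
      MemLp (windowedBerezin α (fracDiff α ψ) (liftTD f)) p haarMeasureTD) ∧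
    Tendsto
      (fun α : ℝ =>
        eLpNorm (windowedBerezin α (fracDiff α ψ) (liftTD f) - liftTD f) p haarMeasureTD)
      atTop (𝓝 0) := by
  have hβ := tsum_normalizedCoeff hψ hψ1
  -- the windows, cut off outside the disc so as to be measurable
  obtain ⟨g, hg⟩ : ∃ g : ℝ → ℂ → ℂ, ∀ α, g α = disc.indicator (fracDiff α ψ) := ⟨_, fun _ => rfl⟩
  have hgeq (α : ℝ) : ∀ z ∈ disc, fracDiff α ψ z = g α z := fun z hz => by
    rw [hg, Set.indicator_of_mem hz]
  have hgb (α : ℝ) (hα : -1 < α) : HasDiscSeries (windowCoeff α ψ) (g α) :=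
    (hasDiscSeries_fracDiff hβ hα).congr fun z hz => (hgeq α z hz).symm
  have hgm (α : ℝ) (hα : -1 < α) : Measurable (g α) := by
    rw [hg]
    exact measurable_indicator_disc (hasDiscSeries_fracDiff hβ hα).differentiableOn.continuousOn
  have hg1 (α : ℝ) (hα : -1 < α) := lintegral_normSq_of_windowCoeff hα hβ (hgm α hα) (hgb α hα)
  have hk (α : ℝ) (hα : -1 < α) :=
    isSymmMarkovDensity_berezinDensity hα (hgm α hα) (hgb α hα) (hg1 α hα)
  have hB (α : ℝ) (hα : -1 < α) {x : Circle × ℂ} (hx : x.2 ∈ disc) :=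
    windowedBerezin_eq_kernelIntegral (hgeq α) hα (hgm α hα) (hgb α hα) (hg1 α hα) hp1 hp
      (memLp_liftTD hf) hx
  -- a strongly measurable representative of `f`
  obtain ⟨f', hf'm, hff'⟩ := hf.1
  have hf' : MemLp f' p moebiusMeasure := hf.ae_eq hff'
  have hlift : liftTD f =ᵐ[haarMeasureTD] liftTD f' :=
    measurePreserving_snd_haarMeasureTD.quasiMeasurePreserving.ae_eq_comp hff'
  have hf'lm : StronglyMeasurable (liftTD f') := hf'm.comp_measurable measurable_snd
  have hB' (α : ℝ) (hα : -1 < α) : windowedBerezin α (fracDiff α ψ) (liftTD f)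
      =ᵐ[haarMeasureTD] kernelIntegral α (g α) (liftTD f') := by
    filter_upwards [ae_snd_mem_disc] with x hx
    rw [(hB α hα hx).2]
    refine integral_congr_ae ?_
    filter_upwards [hlift] with y hy
    rw [hy]
  refine ⟨fun α hα => ⟨fun u z hz => (hB α hα (x := (u, z)) hz).1, ?_⟩, ?_⟩
  · rw [memLp_congr_ae (hB' α hα)]
    refine ⟨(stronglyMeasurable_kernelIntegral α (hgm α hα) hf'lm).aestronglyMeasurable, ?_⟩
    have h1 := (hk α hα).eLpNorm_le_of_enorm_le hp1 hp (G := liftTD f' ∘ Prod.snd)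
      (hf'lm.comp_measurable measurable_snd)
      (ae_of_all _ fun x => enorm_kernelIntegral_le hα (g α) (liftTD f') x)
    rw [eLpNorm_comp_measurePreserving hf'lm.aestronglyMeasurable (hk α hα).measurePreserving_snd]
      at h1
    exact h1.trans_lt (memLp_liftTD hf').2
  · refine tendsto_of_tendsto_of_tendsto_of_le_of_le' tendsto_const_nhds
      (tendsto_eLpNorm_diff_berezinDensity hβ hgm hgb hp1 hp hf'm hf')
      (Eventually.of_forall fun _ => zero_le) ?_
    filter_upwards [eventually_gt_atTop (-1)] with α hα
    rw [eLpNorm_congr_ae ((hB' α hα).sub hlift)]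
    refine (hk α hα).eLpNorm_le_of_enorm_le hp1 hp
      ((hf'lm.comp_measurable measurable_snd).sub (hf'lm.comp_measurable measurable_fst)) ?_
    filter_upwards [ae_snd_mem_disc] with x hx
    exact enorm_kernelIntegral_sub_le hα (hgm α hα) (hgb α hα) (hg1 α hα) hp1 hp
      (memLp_liftTD hf') hx
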